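/- Let $G=(V,E)$ be a graph on $n\ge 1$ vertices. A labeling is a bijection $f:V\to\{1,\dots,n\}$; put $B(f)=\max_{uv\in E}|f(u)-f(v)|$, and let the bandwidth be $B(G)=\min_f B(f)$. For $0<\delta<1$, call $G$ $\delta$-dense if its minimum degree $d_{\min}$ is at least $\delta n$. A set $R'\subseteq V$ is $2$-dominating if every vertex of $G$ is at distance at most $2$ from some vertex of $R'$. Given a set $R'\subseteq V$ of roots, a box size $s$ and a placement of the roots, i.e. a map $p$ from $R'$ to the $\lceil n/s\rceil$ boxes obtained by cutting the positions $1,\dots,n$ into consecutive blocks of size $s$ (the last one possibly shorter), let $I_v$ be the set of boxes $i$ such that $|i-p(u)|\le 2$ for all $u\in R'$ with $d(u,v)\le 2$, $|i-p(u)|\le 3$ for all $u\in R'$ with $d(u,v)\le 3$, and $i=p(v)$ if $v\in R'$. The auxiliary bipartite graph joins each $v\in V$ to all positions in the boxes of $I_v$; a perfect matching of it is a labeling of $G$. Algorithm 1 draws $k$ independent uniformly random vertices, which form $R'$; then it goes through the box sizes $s=d_{\min},d_{\min}+1,\dots,\max(d_{\min},\lfloor n/2\rfloor)$ in increasing order and,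 for each $s$, through all placements of $R'$, and returns the labeling given by the first perfect matching of the auxiliary graph that it finds. Theorem. There is an absolute constant $A$ such that for all $0<\delta<1$ and $0<\alpha<1$ there are numbers $k=k(n)$, with $k(n)\le \frac{A}{\delta}\log\log n$ for all sufficiently large $n$, for which Algorithm 1 can be implemented by one randomized program (on a random access machine with additions, subtractions and uniform random numbers at unit cost) such that for every $\delta$-dense graph $G$ on $n$ vertices: (a) for every outcome of the random choices, the program stops after a number of steps bounded by a polynomial in $n$ (which depends only on $\delta$ and $\alpha$) and returns a labeling $f$ of $G$ as described; and if $R'$ is $2$-dominating, then $B(f)\le 6\,B(G)$; (b) with probability at least $1-\alpha$, $R'$ is $2$-dominating and $B(f)\le 6\,B(G)$. In particular, there is a randomized polynomial-time $6$-approximation algorithm for the bandwidth of $\delta$-dense graphs. -/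

import Mathlib

open Filter

namespace DenseBandwidth

/-! ### Bandwidth, density, dominating sets -/

/-- `B(f)`: the largest label difference `|f u - f v|` over the edges `uv` of `G`. A labeling is a
bijection onto `n` consecutive integers (here `0, …, n - 1`; only differences matter). -/
noncomputable def width {n : ℕ} (G : SimpleGraph (Fin n)) (f : Fin n ≃ Fin n) : ℕ :=
  open scoped Classical in
  (Finset.univ : Finset (Fin n × Fin n)).sup fun e =>
    if G.Adj e.1 e.2 then ((f e.1 : ℤ) - (f e.2 : ℤ)).natAbs else 0

/-- The bandwidth `B(G)`: the minimum of `B(f)` over all labelings `f`. -/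
noncomputable def bandwidth {n : ℕ} (G : SimpleGraph (Fin n)) : ℕ :=
  ⨅ f : Fin n ≃ Fin n, width G f

/-- The minimum degree of `G`. -/
noncomputable def minDeg {n : ℕ} (G : SimpleGraph (Fin n)) : ℕ :=
  open scoped Classical in G.minDegree

/-- `G` is `δ`-dense: every vertex has degree at least `δ n`. -/
def IsDense {n : ℕ} (δ : ℝ) (G : SimpleGraph (Fin n)) : Prop :=
  δ * n ≤ minDeg G

/-- Every vertex is at distance at most `h` from some vertex of `D`. -/
def IsHopDominating {n : ℕ} (G : SimpleGraph (Fin n)) (h : ℕ) (D : Set (Fin n)) : Prop :=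
  ∀ v, ∃ u ∈ D, G.edist u v ≤ h

/-! ### Boxes, auxiliary bipartite graph, and what the algorithm returns

For box size `s` the `n` positions are cut into `⌈n / s⌉` consecutive boxes: position `j` lies in
box `j / s` (the last box may be shorter). -/

/-- The boxes `I_v` open to the vertex `v` once the roots in `R` have been placed by `p`: a root
stays in its box, and `v` is at most two (three) boxes away from every root within distance two
(three). -/
def allowedBoxes {n b : ℕ} (G : SimpleGraph (Fin n)) (R : Set (Fin n)) (p : R → Fin b)
    (v : Fin n) : Set (Fin b) :=
  {i | (∀ u : R, (u : Fin n) = v → i = p u) ∧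
    (∀ u : R, G.edist u v ≤ 2 → |(i : ℤ) - (p u : ℤ)| ≤ 2) ∧
    (∀ u : R, G.edist u v ≤ 3 → |(i : ℤ) - (p u : ℤ)| ≤ 3)}

/-- The auxiliary bipartite graph: vertices of `G` on the left, positions on the right; `v` is
joined to all positions in the boxes of `I_v`. -/
def auxGraph {n : ℕ} (G : SimpleGraph (Fin n)) (R : Set (Fin n)) (s : ℕ)
    (p : R → Fin (n ⌈/⌉ s)) : SimpleGraph (Fin n ⊕ Fin n) :=
  SimpleGraph.fromRel fun x y =>
    ∃ v j, x = Sum.inl v ∧ y = Sum.inr j ∧ ∃ i ∈ allowedBoxes G R p v, (i : ℕ) = (j : ℕ) / s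

/-- `f` is the layout given by some perfect matching of the auxiliary graph. -/
def IsMatchingLayout {n : ℕ} (G : SimpleGraph (Fin n)) (R : Set (Fin n)) (s : ℕ)
    (p : R → Fin (n ⌈/⌉ s)) (f : Fin n ≃ Fin n) : Prop :=
  ∃ M : (auxGraph G R s p).Subgraph, M.IsPerfectMatching ∧
    ∀ v, M.Adj (Sum.inl v) (Sum.inr (f v))

/-- `f` is a possible result of the main loop with root set `R`: box sizes are tried in increasing
order, from the minimum degree up to `n / 2` (only the minimum degree itself, if that is larger than
`n / 2`); for each of them all placements of the roots are tried; and the layout of the first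
perfect matching that is found is returned. Neither the order in which placements are tried nor the
choice among several perfect matchings is prescribed. -/
def IsResult {n : ℕ} (G : SimpleGraph (Fin n)) (R : Set (Fin n)) (f : Fin n ≃ Fin n) : Prop :=
  ∃ s, minDeg G ≤ s ∧ s ≤ max (minDeg G) (n / 2) ∧
    (∃ p : R → Fin (n ⌈/⌉ s), IsMatchingLayout G R s p f) ∧
    ∀ s', minDeg G ≤ s' → s' < s → ∀ (p : R → Fin (n ⌈/⌉ s')) (g : Fin n ≃ Fin n),
      ¬ IsMatchingLayout G R s' p g

/-! ### Randomized programs and their running time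

Structured random-access programs over natural numbers with variables, arrays, branching, counted
loops and uniform random numbers. Arithmetic is restricted to addition and truncated subtraction, so
that unit cost per operation is a realistic measure: the number of digits grows by at most one per
step. -/

/-- Expressions: constants, variables, array entries, sums, truncated differences. -/
inductive Expr : Type
  | const (c : ℕ) : Expr
  | var (x : ℕ) : Expr
  | get (a : ℕ) (i : Expr) : Expr
  | add (e₁ e₂ : Expr) : Expr
  | sub (e₁ e₂ : Expr) : Expr

/-- Programs. -/
inductive Cmd : Type
  | skip : Cmd
  | set (x : ℕ) (e : Expr) : Cmd
  | put (a : ℕ) (i e : Expr) : Cmd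
  | rand (x : ℕ) (e : Expr) : Cmd
  | seq (c₁ c₂ : Cmd) : Cmd
  | ite (e : Expr) (c₁ c₂ : Cmd) : Cmd
  | loop (x : ℕ) (e : Expr) (c : Cmd) : Cmd

/-- Memory contents: the variables and the arrays. -/
structure Mem : Type where
  var : ℕ → ℕ
  arr : ℕ → ℕ → ℕ

/-- Assignment to the variable `x`. -/
def Mem.setVar (m : Mem) (x k : ℕ) : Mem :=
  { m with var := Function.update m.var x k }

/-- Assignment to the entry `i` of the array `a`. -/
def Mem.setArr (m : Mem) (a i k : ℕ) : Mem :=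
  { m with arr := Function.update m.arr a (Function.update (m.arr a) i k) }

/-- Value of an expression. -/
def Expr.eval : Expr → Mem → ℕ
  | const c, _ => c
  | var x, m => m.var x
  | get a i, m => m.arr a (i.eval m)
  | add e₁ e₂, m => e₁.eval m + e₂.eval m
  | sub e₁ e₂, m => e₁.eval m - e₂.eval m

/-- Number of steps needed to evaluate an expression: one per operation. -/
def Expr.cost : Expr → ℕ
  | const _ => 1
  | var _ => 1
  | get _ i => i.cost + 1
  | add e₁ e₂ => e₁.cost + e₂.cost + 1
  | sub e₁ e₂ => e₁.cost + e₂.cost + 1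

/-- A uniformly random element of `{0, …, k - 1}` (and `0` if `k = 0`). -/
noncomputable def uniformBelow : ℕ → PMF ℕ
  | 0 => PMF.pure 0
  | k + 1 => (PMF.uniformOfFintype (Fin (k + 1))).map fun i => (i : ℕ)

/-- The joint distribution of the final memory and the number of steps.
`rand x e` stores a fresh uniform number below the value of `e` in `x`; `ite e c₁ c₂` runs `c₁` if
the value of `e` is nonzero and `c₂` otherwise; `loop x e c` evaluates `e` once, to `k`, and runs
`c` for `x = 0, …, k - 1`. -/
noncomputable def Cmd.run : Cmd → Mem → PMF (Mem × ℕ)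
  | skip, m => PMF.pure (m, 1)
  | set x e, m => PMF.pure (m.setVar x (e.eval m), e.cost + 1)
  | put a i e, m => PMF.pure (m.setArr a (i.eval m) (e.eval m), i.cost + e.cost + 1)
  | rand x e, m => (uniformBelow (e.eval m)).map fun k => (m.setVar x k, e.cost + 1)
  | seq c₁ c₂, m =>
      (c₁.run m).bind fun o₁ => (c₂.run o₁.1).map fun o₂ => (o₂.1, o₁.2 + o₂.2)
  | ite e c₁ c₂, m =>
      (if e.eval m ≠ 0 then c₁.run m else c₂.run m).map fun o => (o.1, o.2 + (e.cost + 1))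
  | loop x e c, m =>
      Nat.rec (PMF.pure (m, e.cost + 1))
        (fun k r => r.bind fun o₁ =>
          (c.run (o₁.1.setVar x k)).map fun o₂ => (o₂.1, o₁.2 + o₂.2 + 1))
        (e.eval m)

/-- The input: variable `0` holds `n`, array `0` holds the adjacency matrix of `G` row by row, and
everything else is zero. -/
noncomputable def input {n : ℕ} (G : SimpleGraph (Fin n)) : Mem where
  var x := if x = 0 then n else 0
  arr a i := open scoped Classical in
    if a = 0 ∧ ∃ u v : Fin n, G.Adj u v ∧ i = (u : ℕ) * n + (v : ℕ) then 1 else 0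

/-- The first `k` entries of array `2` are the vertices `r`: the random roots. -/
def RootsAre {n k : ℕ} (m : Mem) (r : Fin k → Fin n) : Prop :=
  ∀ i : Fin k, m.arr 2 i = (r i : ℕ)

/-- The first `n` entries of array `1` are the labels `f v`: the returned layout. -/
def LayoutIs {n : ℕ} (m : Mem) (f : Fin n ≃ Fin n) : Prop :=
  ∀ v : Fin n, m.arr 1 v = (f v : ℕ)

end DenseBandwidth

/-! Approximation. Every layout has width at least `minDeg G`, because the vertex at the first
position has all its neighbours to its right. A layout of width at most `s` moves labels by at most
`h * s` over distance `h`, so with box size `s` it satisfies all box constraints for the placement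
it induces itself (`spread_of_width_le`). Hence the first successful box size is at most the
bandwidth (`le_bandwidth_of_no_spread`). Conversely, if the roots are 2-dominating, the ends of an
edge lie within 2 and 3 boxes of a common root, so their labels differ by less than `6 * s`
(`width_le_of_spread`).

Matching. The positions open to a vertex form an interval, so filling positions from left to right
with the vertex whose interval ends first finds a perfect matching if there is one
(`greedy_extends`, an exchange argument).

Roots. A dense graph has a dominating set `D` of size `O(log n)`. Random roots that meet the
neighbourhood of every member of `D` are 2-dominating, so a union bound over `D` rather than over
all vertices makes `O(log log n)` roots suffice. Density leaves a constant number of boxes, so the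
placements number a constant to the power `k`, which is polynomial in `n`
(`two_pow_mul_rootCount_le`).

Program. All loops are bounded by one number `X`, polynomial in `n`, and the cost is at most `X` to
an exponent read off the program text. Only the drawing of the roots is random; the remainder is a
deterministic function of the tuple drawn, and is verified with loop invariants (`Runs`, `Ev`). -/

namespace DenseBandwidth

/-! ### Deterministic runs with a cost bound -/

/-- An exponent for the cost of a program, computed from its text. -/
def Cmd.deg : Cmd → ℕ
  | skip => 1
  | set _ e => e.cost + 1
  | put _ i e => i.cost + e.cost + 1
  | rand _ e => e.cost + 1
  | seq c₁ c₂ => c₁.deg + c₂.deg + 1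
  | ite e c₁ c₂ => e.cost + c₁.deg + c₂.deg + 2
  | loop _ e c => e.cost + c.deg + 3

/-- The program `c` runs deterministically from `m`, at cost at most `X ^ c.deg`, and ends in a
memory satisfying `Q`. -/
def Runs (X : ℕ) (c : Cmd) (m : Mem) (Q : Mem → Prop) : Prop :=
  ∃ m' t, c.run m = PMF.pure (m', t) ∧ t ≤ X ^ c.deg ∧ Q m'

/-- Two numbers that are at least 1 have a sum of at most twice their product; the extra factor `X`
pays for the 2. This lets `Cmd.deg` add up exponents without tracking constants. -/
theorem add_le_pow_add {X a b : ℕ} (hX : 2 ≤ X) : X ^ a + X ^ b ≤ X ^ (a + b + 1) := by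
  have h1 : 1 ≤ X ^ a := Nat.one_le_pow _ _ (by omega)
  have h2 : 1 ≤ X ^ b := Nat.one_le_pow _ _ (by omega)
  have h : X ^ a + X ^ b ≤ X ^ a * X ^ b * 2 := by nlinarith
  calc X ^ a + X ^ b ≤ X ^ a * X ^ b * 2 := h
    _ ≤ X ^ a * X ^ b * X := Nat.mul_le_mul_left _ hX
    _ = X ^ (a + b + 1) := by ring

theorem le_pow_self' {X a : ℕ} (hX : 2 ≤ X) : a ≤ X ^ a :=
  (Nat.lt_pow_self (by omega)).le

theorem ite_cost_le {X a b c t : ℕ} (hX : 2 ≤ X) (h : t ≤ X ^ a ∨ t ≤ X ^ b) :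
    t + (c + 1) ≤ X ^ (c + a + b + 2) := by
  have h0 : t ≤ X ^ (a + b) := h.elim
    (fun h => h.trans (Nat.pow_le_pow_right (by omega) (by omega)))
    (fun h => h.trans (Nat.pow_le_pow_right (by omega) (by omega)))
  have h1 : c + 1 ≤ X ^ (c + 1) := le_pow_self' hX
  calc t + (c + 1) ≤ X ^ (a + b) + X ^ (c + 1) := by omega
    _ ≤ X ^ (a + b + (c + 1) + 1) := add_le_pow_add hX
    _ = _ := by ring_nf

theorem loop_cost_le {X a c N : ℕ} (hX : 2 ≤ X) (hN : N ≤ X) :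
    (c + 1) + N * (X ^ a + 1) ≤ X ^ (c + a + 3) := by
  have h1 : c + 1 ≤ X ^ (c + 1) := le_pow_self' hX
  have h2 : 1 ≤ X ^ a := Nat.one_le_pow _ _ (by omega)
  have h4 : N * (X ^ a + 1) ≤ X ^ (a + 2) := by
    calc N * (X ^ a + 1) ≤ X * (X ^ a * X) := Nat.mul_le_mul hN (by nlinarith)
      _ = X ^ (a + 2) := by ring
  have h5 : X ^ (c + 1) + X ^ (a + 2) ≤ X ^ (c + a + 3) := by
    have e1 : X ^ (c + 1) ≤ X ^ (c + a + 2) := Nat.pow_le_pow_right (by omega) (by omega)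
    have e2 : X ^ (a + 2) ≤ X ^ (c + a + 2) := Nat.pow_le_pow_right (by omega) (by omega)
    calc X ^ (c + 1) + X ^ (a + 2) ≤ X ^ (c + a + 2) * 2 := by omega
      _ ≤ X ^ (c + a + 2) * X := Nat.mul_le_mul_left _ hX
      _ = _ := by ring
  omega

theorem Runs.imp {X : ℕ} {c : Cmd} {m : Mem} {Q Q' : Mem → Prop} (h : Runs X c m Q)
    (hQ : ∀ m', Q m' → Q' m') : Runs X c m Q' := by
  obtain ⟨m', t, h1, h2, h3⟩ := h
  exact ⟨m', t, h1, h2, hQ _ h3⟩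

theorem Runs.skip {X : ℕ} (hX : 2 ≤ X) {m : Mem} {Q : Mem → Prop} (h : Q m) :
    Runs X .skip m Q :=
  ⟨m, 1, rfl, by simp [Cmd.deg]; omega, h⟩

theorem Runs.set {X : ℕ} (hX : 2 ≤ X) {m : Mem} {Q : Mem → Prop} {x : ℕ} {e : Expr}
    (h : Q (m.setVar x (e.eval m))) : Runs X (.set x e) m Q :=
  ⟨_, _, rfl, le_pow_self' hX, h⟩

theorem Runs.put {X : ℕ} (hX : 2 ≤ X) {m : Mem} {Q : Mem → Prop} {a : ℕ} {i e : Expr}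
    (h : Q (m.setArr a (i.eval m) (e.eval m))) : Runs X (.put a i e) m Q :=
  ⟨_, _, rfl, le_pow_self' hX, h⟩

theorem Runs.seq {X : ℕ} (hX : 2 ≤ X) {m : Mem} {Q : Mem → Prop} {c₁ c₂ : Cmd}
    (h : Runs X c₁ m fun m' => Runs X c₂ m' Q) : Runs X (.seq c₁ c₂) m Q := by
  obtain ⟨m', t, h1, h2, m'', t', h3, h4, h5⟩ := h
  refine ⟨m'', t + t', ?_, ?_, h5⟩
  · simp [Cmd.run, h1, h3, PMF.pure_bind, PMF.pure_map]
  · exact (Nat.add_le_add h2 h4).trans (add_le_pow_add hX)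

theorem Runs.ite {X : ℕ} (hX : 2 ≤ X) {m : Mem} {Q : Mem → Prop} {e : Expr} {c₁ c₂ : Cmd}
    (h₁ : e.eval m ≠ 0 → Runs X c₁ m Q) (h₂ : e.eval m = 0 → Runs X c₂ m Q) :
    Runs X (.ite e c₁ c₂) m Q := by
  by_cases h : e.eval m = 0
  · obtain ⟨m', t, h1, h2, h3⟩ := h₂ h
    exact ⟨m', t + (e.cost + 1), by simp [Cmd.run, h, h1, PMF.pure_map],
      ite_cost_le hX (.inr h2), h3⟩
  · obtain ⟨m', t, h1, h2, h3⟩ := h₁ h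
    exact ⟨m', t + (e.cost + 1), by simp [Cmd.run, h, h1, PMF.pure_map],
      ite_cost_le hX (.inl h2), h3⟩

theorem Runs.loop {X : ℕ} (hX : 2 ≤ X) {m : Mem} {Q : Mem → Prop} {x : ℕ} {e : Expr} {c : Cmd}
    (I : ℕ → Mem → Prop) (hN : e.eval m ≤ X) (h0 : I 0 m)
    (hs : ∀ k < e.eval m, ∀ m', I k m' → Runs X c (m'.setVar x k) (I (k + 1)))
    (hQ : ∀ m', I (e.eval m) m' → Q m') : Runs X (.loop x e c) m Q := by
  have key : ∀ N ≤ e.eval m, ∃ m' t, (Nat.rec (PMF.pure (m, e.cost + 1))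
        (fun k r => r.bind fun o₁ =>
          (c.run (o₁.1.setVar x k)).map fun o₂ => (o₂.1, o₁.2 + o₂.2 + 1)) N : PMF (Mem × ℕ))
        = PMF.pure (m', t) ∧ t ≤ (e.cost + 1) + N * (X ^ c.deg + 1) ∧ I N m' := by
    intro N
    induction N with
    | zero => intro _; exact ⟨m, _, rfl, by simp, h0⟩
    | succ N ih =>
      intro hN'
      obtain ⟨m', t, h1, h2, h3⟩ := ih (by omega)
      obtain ⟨m'', t', h4, h5, h6⟩ := hs N (by omega) m' h3
      refine ⟨m'', t + t' + 1, ?_, ?_, h6⟩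
      · simp only [h1, PMF.pure_bind, h4, PMF.pure_map]
      · rw [Nat.succ_mul]; omega
  obtain ⟨m', t, h1, h2, h3⟩ := key _ le_rfl
  exact ⟨m', t, h1, h2.trans (loop_cost_le hX hN), hQ _ h3⟩

/-! ### Functional terms

A term is compiled for a level `d`: the code leaves its value in the variable `d` and uses only
variables from `d` on as scratch space. -/

/-- The memories `m` and `m'` agree on the arrays and on the variables below `d`. -/
def Agree (d : ℕ) (m m' : Mem) : Prop := (∀ z < d, m'.var z = m.var z) ∧ m'.arr = m.arr

theorem Agree.refl (d : ℕ) (m : Mem) : Agree d m m := ⟨fun _ _ => rfl, rfl⟩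

theorem Agree.trans {d d' : ℕ} {m m' m'' : Mem} (hd : d ≤ d') (h : Agree d m m')
    (h' : Agree d' m' m'') : Agree d m m'' :=
  ⟨fun z hz => (h'.1 z (by omega)).trans (h.1 z hz), h'.2.trans h.2⟩

theorem Agree.setVar {d x k : ℕ} {m m' : Mem} (h : Agree d m m') (hx : d ≤ x) :
    Agree d m (m'.setVar x k) :=
  ⟨fun z hz => by
    rw [← h.1 z hz]; simp [Mem.setVar, Function.update_of_ne (show z ≠ x by omega)], h.2⟩

theorem setVar_var_self (m : Mem) (x k : ℕ) : (m.setVar x k).var x = k := by simp [Mem.setVar]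

theorem setVar_var_ne (m : Mem) {x y : ℕ} (k : ℕ) (h : y ≠ x) :
    (m.setVar x k).var y = m.var y := by simp [Mem.setVar, h]

theorem setVar_arr (m : Mem) (x k : ℕ) : (m.setVar x k).arr = m.arr := rfl

theorem setArr_var (m : Mem) (a i k : ℕ) : (m.setArr a i k).var = m.var := rfl

theorem setArr_arr_ne (m : Mem) {a b : ℕ} (i k : ℕ) (h : b ≠ a) :
    (m.setArr a i k).arr b = m.arr b := by simp [Mem.setArr, h]

theorem setArr_arr_self (m : Mem) (a i k : ℕ) :
    (m.setArr a i k).arr a = Function.update (m.arr a) i k := by simp [Mem.setArr]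

/-- Terms: code for every level. -/
abbrev Tm := ℕ → Cmd

/-- In all memories that agree with `m` below `d`, and at all levels from `d` on, the term `t` has
the value `v`. -/
def Ev (X : ℕ) (t : Tm) (d : ℕ) (m : Mem) (v : ℕ) : Prop :=
  ∀ d' ≥ d, ∀ m', Agree d m m' →
    Runs X (t d') m' fun m'' => Agree d' m' m'' ∧ m''.var d' = v

theorem Ev.mono {X : ℕ} {t : Tm} {d d₁ : ℕ} {m m₁ : Mem} {v : ℕ} (h : Ev X t d m v)
    (hd : d ≤ d₁) (hm : Agree d m m₁) : Ev X t d₁ m₁ v :=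
  fun d' hd' m' hm' => h d' (hd.trans hd') m' (hm.trans hd hm')

theorem Ev.of_eq {X : ℕ} {t : Tm} {d : ℕ} {m : Mem} {u v : ℕ} (h : Ev X t d m u) (e : u = v) :
    Ev X t d m v :=
  e ▸ h

theorem Ev.run {X : ℕ} {t : Tm} {d : ℕ} {m : Mem} {v : ℕ} (h : Ev X t d m v) :
    Runs X (t d) m fun m' => Agree d m m' ∧ m'.var d = v :=
  h d le_rfl m (Agree.refl d m)

namespace Tm

def const (c : ℕ) : Tm := fun d => .set d (.const c)
def var (x : ℕ) : Tm := fun d => .set d (.var x)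
def get (a : ℕ) (t : Tm) : Tm := fun d => .seq (t d) (.set d (.get a (.var d)))
def add (s t : Tm) : Tm := fun d =>
  .seq (s d) (.seq (t (d + 1)) (.set d (.add (.var d) (.var (d + 1)))))
def sub (s t : Tm) : Tm := fun d =>
  .seq (s d) (.seq (t (d + 1)) (.set d (.sub (.var d) (.var (d + 1)))))
/-- Iteration: the result of `b` becomes the next accumulator. -/
def fold (N i : Tm) (b : Tm → Tm → Tm) : Tm := fun d =>
  -- Slot `d` holds the accumulator. Slot `d + 1` holds the number of rounds and then the counter,
  -- which is safe because a loop evaluates its bound only once.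
  .seq (i d) (.seq (N (d + 1)) (.loop (d + 1) (.var (d + 1))
    (.seq (b (var (d + 1)) (var d) (d + 2)) (.set d (.var (d + 2))))))

end Tm

section rules

variable {X : ℕ} (hX : 2 ≤ X) {d : ℕ} {m : Mem} {s t : Tm} {u v : ℕ}
include hX

theorem Ev.const (c : ℕ) : Ev X (Tm.const c) d m c := fun _ _ _ _ =>
  Runs.set hX ⟨(Agree.refl _ _).setVar le_rfl, setVar_var_self ..⟩

theorem Ev.var {x : ℕ} (hx : x < d) : Ev X (Tm.var x) d m (m.var x) := fun _ _ _ hm =>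
  Runs.set hX ⟨(Agree.refl _ _).setVar le_rfl, by
    rw [setVar_var_self, Expr.eval, hm.1 x hx]⟩

theorem Ev.get (a : ℕ) (h : Ev X t d m v) : Ev X (Tm.get a t) d m (m.arr a v) :=
  fun d' hd' m' hm => Runs.seq hX <| (h d' hd' m' hm).imp fun m'' h' =>
    Runs.set hX ⟨h'.1.setVar le_rfl, by
      rw [setVar_var_self, Expr.eval, Expr.eval, h'.2, h'.1.2, hm.2]⟩

theorem Ev.add (hs : Ev X s d m u) (ht : Ev X t d m v) : Ev X (Tm.add s t) d m (u + v) :=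
  fun d' hd' m' hm => Runs.seq hX <| (hs d' hd' m' hm).imp fun m₁ h₁ =>
    Runs.seq hX <| (ht (d' + 1) (by omega) m₁ (hm.trans hd' h₁.1)).imp fun m₂ h₂ =>
      Runs.set hX ⟨(h₁.1.trans (by omega) h₂.1).setVar le_rfl, by
        rw [setVar_var_self, Expr.eval, Expr.eval, Expr.eval, h₂.2, h₂.1.1 _ (by omega), h₁.2]⟩

theorem Ev.sub (hs : Ev X s d m u) (ht : Ev X t d m v) : Ev X (Tm.sub s t) d m (u - v) :=
  fun d' hd' m' hm => Runs.seq hX <| (hs d' hd' m' hm).imp fun m₁ h₁ =>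
    Runs.seq hX <| (ht (d' + 1) (by omega) m₁ (hm.trans hd' h₁.1)).imp fun m₂ h₂ =>
      Runs.set hX ⟨(h₁.1.trans (by omega) h₂.1).setVar le_rfl, by
        rw [setVar_var_self, Expr.eval, Expr.eval, Expr.eval, h₂.2, h₂.1.1 _ (by omega), h₁.2]⟩

/-- The rounds change scratch variables, so the body must be correct in every memory that agrees
with `m` below `d`. Since `Ev` is stable under such changes (`Ev.mono`), facts about outer terms can
be reused inside the body. -/
theorem Ev.fold {N i : Tm} {b : Tm → Tm → Tm} {k : ℕ} {F : ℕ → ℕ} (hN : Ev X N d m k)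
    (hk : k ≤ X) (hi : Ev X i d m (F 0))
    (hb : ∀ d₁ ≥ d, ∀ m₁, Agree d m m₁ → ∀ j < k, ∀ x y, Ev X x d₁ m₁ j →
      Ev X y d₁ m₁ (F j) → Ev X (b x y) d₁ m₁ (F (j + 1))) :
    Ev X (Tm.fold N i b) d m (F k) := by
  intro d' hd' m' hm
  refine Runs.seq hX <| (hi d' hd' m' hm).imp fun m₁ h₁ => Runs.seq hX <|
    (hN (d' + 1) (by omega) m₁ (hm.trans hd' h₁.1)).imp fun m₂ h₂ => ?_
  have e : (Expr.var (d' + 1)).eval m₂ = k := h₂.2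
  refine Runs.loop hX (fun j m₃ => Agree d' m' m₃ ∧ m₃.var d' = F j) (by rw [e]; exact hk)
    ⟨h₁.1.trans (by omega) h₂.1, (h₂.1.1 _ (by omega)).trans h₁.2⟩ ?_ ?_
  · rw [e]
    rintro j hj m₃ ⟨h₃, h₄⟩
    set m₄ := m₃.setVar (d' + 1) j with hm₄
    have h₅ : Agree d' m' m₄ := h₃.setVar (by omega)
    have := hb (d' + 2) (by omega) m₄ (hm.trans hd' h₅) j hj (Tm.var (d' + 1)) (Tm.var d')
      (by have := Ev.var hX (m := m₄) (show d' + 1 < d' + 2 by omega)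
          rwa [hm₄, setVar_var_self] at this)
      (by have := Ev.var hX (m := m₄) (show d' < d' + 2 by omega)
          rwa [hm₄, setVar_var_ne _ _ (by omega), h₄] at this)
    refine Runs.seq hX <| this.run.imp fun m₆ h₆ => Runs.set hX
      ⟨(h₅.trans (by omega) h₆.1).setVar le_rfl, ?_⟩
    rw [setVar_var_self, Expr.eval, h₆.2]
  · rw [e]
    exact fun m' h => h

end rules

/-! ### Derived terms -/

open scoped Classical in
/-- The truth value of `p`. -/
noncomputable def ind (p : Prop) : ℕ := if p then 1 else 0

theorem ind_ne_zero {p : Prop} : ind p ≠ 0 ↔ p := by unfold ind; split_ifs <;> simp_all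

theorem ind_congr {p q : Prop} (h : p ↔ q) : ind p = ind q := by rw [propext h]

theorem ind_true {p : Prop} (h : p) : ind p = 1 := by simp [ind, h]
theorem ind_false {p : Prop} (h : ¬ p) : ind p = 0 := by simp [ind, h]

namespace Tm

def sum (N : Tm) (g : Tm → Tm) : Tm := fold N (const 0) fun x y => add y (g x)
-- The machine has no multiplication: the first factor is a number of loop rounds, whence the
-- hypothesis `u ≤ X` in `Ev.mul`.
def mul (s t : Tm) : Tm := sum s fun _ => t
def pow2 (t : Tm) : Tm := fold t (const 1) fun _ y => add y y
def not (t : Tm) : Tm := sub (const 1) t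
def or (s t : Tm) : Tm := not (not (add s t))
def and (s t : Tm) : Tm := not (add (not s) (not t))
def imp (s t : Tm) : Tm := or (not s) t
def le (s t : Tm) : Tm := not (sub s t)
def lt (s t : Tm) : Tm := not (le t s)
def eq (s t : Tm) : Tm := and (le s t) (le t s)
def ex (N : Tm) (g : Tm → Tm) : Tm := not (not (sum N g))
def all (N : Tm) (g : Tm → Tm) : Tm := not (sum N fun x => not (g x))
/-- The least `x < N` with `g x`, and `N` if there is none. -/
def find (N : Tm) (g : Tm → Tm) : Tm :=
  sum N fun x => all (add x (const 1)) fun y => not (g y)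
def div (s t : Tm) : Tm := sum s fun x => le (mul (add x (const 1)) t) s
def mod (s t : Tm) : Tm := sub s (mul (div s t) t)
def log2 (t : Tm) : Tm := sum t fun x => le (pow2 (add x (const 1))) t

end Tm

section derived

variable {X : ℕ} (hX : 2 ≤ X) {d : ℕ} {m : Mem} {s t : Tm} {u v : ℕ} {p q : Prop}
include hX

theorem Ev.sum {N : Tm} {g : Tm → Tm} {k : ℕ} {F : ℕ → ℕ} (hN : Ev X N d m k) (hk : k ≤ X)
    (hg : ∀ d₁ ≥ d, ∀ m₁, Agree d m m₁ → ∀ j < k, ∀ x, Ev X x d₁ m₁ j →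
      Ev X (g x) d₁ m₁ (F j)) :
    Ev X (Tm.sum N g) d m (∑ j ∈ Finset.range k, F j) :=
  Ev.fold hX (F := fun k => ∑ j ∈ Finset.range k, F j) hN hk (Ev.const hX 0)
    fun d₁ hd m₁ hm j hj x y hx hy => by
      simp only [Finset.sum_range_succ]
      exact Ev.add hX hy (hg d₁ hd m₁ hm j hj x hx)

theorem Ev.mul (hs : Ev X s d m u) (ht : Ev X t d m v) (hu : u ≤ X) :
    Ev X (Tm.mul s t) d m (u * v) := by
  exact Ev.of_eq (Ev.sum hX (F := fun _ => v) hs hu fun d₁ hd m₁ hm _ _ _ _ => ht.mono hd hm)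
    (by simp)

theorem Ev.pow2 (ht : Ev X t d m v) (hv : v ≤ X) : Ev X (Tm.pow2 t) d m (2 ^ v) :=
  Ev.fold hX (F := fun k => 2 ^ k) ht hv (Ev.const hX 1) fun _ _ _ _ j _ _ _ _ hy => by
    have := Ev.add hX hy hy
    rwa [← two_mul, ← pow_succ'] at this

theorem Ev.not (ht : Ev X t d m (ind p)) : Ev X (Tm.not t) d m (ind (¬ p)) := by
  refine Ev.of_eq (Ev.sub hX (Ev.const hX 1) ht) ?_
  by_cases p <;> simp [ind, *]

theorem Ev.not_not (ht : Ev X t d m v) : Ev X (Tm.not (Tm.not t)) d m (ind (v ≠ 0)) := by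
  refine Ev.of_eq (Ev.sub hX (Ev.const hX 1) (Ev.sub hX (Ev.const hX 1) ht)) ?_
  unfold ind
  split_ifs <;> omega

theorem Ev.or (hs : Ev X s d m (ind p)) (ht : Ev X t d m (ind q)) :
    Ev X (Tm.or s t) d m (ind (p ∨ q)) := by
  refine Ev.of_eq (Ev.not_not hX (Ev.add hX hs ht)) ?_
  by_cases p <;> by_cases q <;> simp [ind, *]

theorem Ev.and (hs : Ev X s d m (ind p)) (ht : Ev X t d m (ind q)) :
    Ev X (Tm.and s t) d m (ind (p ∧ q)) := by
  refine Ev.of_eq (Ev.sub hX (Ev.const hX 1) (Ev.add hX (Ev.not hX hs) (Ev.not hX ht))) ?_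
  by_cases p <;> by_cases q <;> simp [ind, *]

theorem Ev.imp (hs : Ev X s d m (ind p)) (ht : Ev X t d m (ind q)) :
    Ev X (Tm.imp s t) d m (ind (p → q)) := by
  rw [ind_congr imp_iff_not_or]
  exact Ev.or hX (Ev.not hX hs) ht

theorem Ev.le (hs : Ev X s d m u) (ht : Ev X t d m v) : Ev X (Tm.le s t) d m (ind (u ≤ v)) := by
  refine Ev.of_eq (Ev.sub hX (Ev.const hX 1) (Ev.sub hX hs ht)) ?_
  unfold ind
  split_ifs <;> omega

theorem Ev.lt (hs : Ev X s d m u) (ht : Ev X t d m v) : Ev X (Tm.lt s t) d m (ind (u < v)) := by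
  rw [ind_congr (not_le (a := v) (b := u)).symm]
  exact Ev.not hX (Ev.le hX ht hs)

theorem Ev.eq (hs : Ev X s d m u) (ht : Ev X t d m v) : Ev X (Tm.eq s t) d m (ind (u = v)) := by
  rw [ind_congr (le_antisymm_iff (a := u) (b := v))]
  exact Ev.and hX (Ev.le hX hs ht) (Ev.le hX ht hs)

theorem Ev.ex {N : Tm} {g : Tm → Tm} {k : ℕ} {F : ℕ → Prop} (hN : Ev X N d m k) (hk : k ≤ X)
    (hg : ∀ d₁ ≥ d, ∀ m₁, Agree d m m₁ → ∀ j < k, ∀ x, Ev X x d₁ m₁ j →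
      Ev X (g x) d₁ m₁ (ind (F j))) :
    Ev X (Tm.ex N g) d m (ind (∃ j < k, F j)) := by
  refine Ev.of_eq (Ev.not_not hX (Ev.sum hX hN hk hg)) ?_
  refine ind_congr ?_
  rw [Ne, Finset.sum_eq_zero_iff, not_forall]
  refine exists_congr fun j => ?_
  rw [Classical.not_imp, Finset.mem_range, ← Ne, ind_ne_zero]

theorem Ev.all {N : Tm} {g : Tm → Tm} {k : ℕ} {F : ℕ → Prop} (hN : Ev X N d m k) (hk : k ≤ X)
    (hg : ∀ d₁ ≥ d, ∀ m₁, Agree d m m₁ → ∀ j < k, ∀ x, Ev X x d₁ m₁ j →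
      Ev X (g x) d₁ m₁ (ind (F j))) :
    Ev X (Tm.all N g) d m (ind (∀ j < k, F j)) := by
  refine Ev.of_eq (Ev.sub hX (Ev.const hX 1) (Ev.sum hX hN hk
    fun d₁ hd m₁ hm j hj x hx => Ev.not hX (hg d₁ hd m₁ hm j hj x hx))) ?_
  by_cases h : ∀ j < k, F j
  · rw [ind_true h, Finset.sum_eq_zero fun j hj => ind_false (by simpa using h j (by simpa using hj)),
      Nat.sub_zero]
  · rw [ind_false h]
    have : ∑ j ∈ Finset.range k, ind (¬ F j) ≠ 0 := by
      push Not at h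
      obtain ⟨j, hj, h⟩ := h
      rw [Ne, Finset.sum_eq_zero_iff, not_forall]
      exact ⟨j, by simp [hj, ind, h]⟩
    omega

end derived

/-- Quotients, logarithms, minimum degrees and least witnesses are all computed this way, by
counting an initial segment. -/
theorem sum_ind_eq {N a : ℕ} {F : ℕ → Prop} (ha : a ≤ N) (h : ∀ j < N, F j ↔ j < a) :
    ∑ j ∈ Finset.range N, ind (F j) = a := by
  rw [Finset.sum_congr rfl fun j hj => ind_congr (h j (by simpa using hj))]
  rw [← Finset.sum_subset (Finset.range_subset_range.2 ha) fun j _ hj => ind_false (by simpa using hj),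
    Finset.sum_congr rfl fun j hj => ind_true (by simpa using hj)]
  simp

theorem sum_ind_find (N : ℕ) (F : ℕ → Prop) :
    let v := ∑ j ∈ Finset.range N, ind (∀ i < j + 1, ¬ F i)
    (v < N ∧ F v) ∨ (v = N ∧ ∀ i < N, ¬ F i) := by
  classical
  by_cases h : ∃ a < N, F a
  · have h' : ∃ a, F a := h.imp fun _ h => h.2
    have h1 : Nat.find h' < N := by
      obtain ⟨a, ha, hF⟩ := h
      exact (Nat.find_le hF).trans_lt ha
    left
    rw [sum_ind_eq h1.le fun j _ => by
      rw [Nat.lt_find_iff]; exact forall_congr' fun i => by rw [Nat.lt_succ_iff]]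
    exact ⟨h1, Nat.find_spec h'⟩
  · push Not at h
    right
    exact ⟨sum_ind_eq le_rfl fun j hj => by simp only [hj, iff_true]; intro i hi; exact h i (by omega), h⟩

/-! ### Least witnesses, division and logarithms. -/

section derived

variable {X : ℕ} (hX : 2 ≤ X) {d : ℕ} {m : Mem} {s t : Tm} {u v : ℕ} {p q : Prop}
include hX

theorem Ev.find {N : Tm} {g : Tm → Tm} {k : ℕ} {F : ℕ → Prop} (hN : Ev X N d m k) (hk : k ≤ X)
    (hg : ∀ d₁ ≥ d, ∀ m₁, Agree d m m₁ → ∀ j < k, ∀ x, Ev X x d₁ m₁ j →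
      Ev X (g x) d₁ m₁ (ind (F j))) :
    ∃ v, Ev X (Tm.find N g) d m v ∧ ((v < k ∧ F v) ∨ (v = k ∧ ∀ i < k, ¬ F i)) :=
  ⟨_, Ev.sum hX hN hk fun _ hd _ hm j hj _ hx =>
    Ev.all hX (Ev.add hX hx (Ev.const hX 1)) (by omega)
      fun d₂ hd' m₂ hm' i hi x hx => Ev.not hX (hg d₂ (by omega) m₂ (hm.trans hd hm') i (by omega)
        x hx), sum_ind_find k F⟩

theorem Ev.div (hs : Ev X s d m u) (ht : Ev X t d m v) (hu : u ≤ X) (hv : 0 < v) :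
    Ev X (Tm.div s t) d m (u / v) := by
  have := Ev.sum hX hs hu fun _ hd _ hm j hj _ hx =>
    Ev.le hX (Ev.mul hX (Ev.add hX hx (Ev.const hX 1)) (ht.mono hd hm) (by omega)) (hs.mono hd hm)
  rwa [sum_ind_eq (Nat.div_le_self u v) fun j _ => by
    rw [← Nat.succ_le_iff, Nat.le_div_iff_mul_le hv]] at this

theorem Ev.mod (hs : Ev X s d m u) (ht : Ev X t d m v) (hu : u ≤ X) (hv : 0 < v) :
    Ev X (Tm.mod s t) d m (u % v) := by
  have := Ev.sub hX hs (Ev.mul hX (Ev.div hX hs ht hu hv) ht ((Nat.div_le_self _ _).trans hu))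
  rwa [mul_comm, ← Nat.mod_eq_sub_mul_div] at this

theorem Ev.log2 (ht : Ev X t d m v) (hv : v ≤ X) : Ev X (Tm.log2 t) d m (Nat.log 2 v) := by
  have := Ev.sum hX ht hv fun _ hd _ hm j hj _ hx =>
    Ev.le hX (Ev.pow2 hX (Ev.add hX hx (Ev.const hX 1)) (by omega)) (ht.mono hd hm)
  rwa [sum_ind_eq (Nat.log_le_self 2 v) fun j hj => by
    rw [← Nat.succ_le_iff, Nat.le_log_iff_pow_le (by norm_num) (by omega)]] at this

end derived

end DenseBandwidth

namespace DenseBandwidth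

/-! ### Bandwidth -/

section width

variable {n : ℕ} {G : SimpleGraph (Fin n)} {f : Fin n ≃ Fin n}

theorem width_le_iff {w : ℕ} :
    width G f ≤ w ↔ ∀ u v, G.Adj u v → (f u : ℕ) ≤ f v + w := by
  classical
  unfold width
  rw [Finset.sup_le_iff]
  constructor
  · intro h u v huv
    have := h (u, v) (Finset.mem_univ _)
    rw [if_pos huv] at this
    simp only at this
    omega
  · rintro h ⟨u, v⟩ -
    split_ifs with huv
    · have h1 := h u v huv
      have h2 := h v u huv.symm
      simp only
      omega
    · exact Nat.zero_le _

theorem exists_width_eq_bandwidth (G : SimpleGraph (Fin n)) :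
    ∃ f : Fin n ≃ Fin n, width G f = bandwidth G :=
  ciInf_mem _

theorem minDeg_le_degree [DecidableRel G.Adj] (v : Fin n) : minDeg G ≤ G.degree v := by
  unfold minDeg
  convert G.minDegree_le_degree v

/-- The neighbours of the vertex labelled 0 have distinct labels between 1 and the width. -/
theorem minDeg_le_width (hn : 0 < n) : minDeg G ≤ width G f := by
  classical
  set u := f.symm ⟨0, hn⟩ with hu
  refine (minDeg_le_degree u).trans ?_
  rw [← G.card_neighborFinset_eq_degree]
  have : (G.neighborFinset u).card ≤ (Finset.Icc 1 (width G f)).card := by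
    refine Finset.card_le_card_of_injOn (fun v => (f v : ℕ)) ?_ ?_
    · intro v hv
      have hv' : G.Adj u v := by simpa using hv
      have h1 := width_le_iff.1 (le_refl (width G f)) v u hv'.symm
      have h2 : (f u : ℕ) = 0 := by simp [hu]
      have h3 : (f v : ℕ) ≠ 0 := by
        intro h0
        exact hv'.ne (f.injective (Fin.ext (h2.trans h0.symm)))
      simp only [Finset.coe_Icc, Set.mem_Icc]
      omega
    · intro v _ w _ h
      exact f.injective (Fin.ext h)
  simpa using this

theorem minDeg_lt (hn : 0 < n) : minDeg G < n := by
  classical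
  refine (minDeg_le_degree ⟨0, hn⟩).trans_lt ?_
  simpa using G.degree_lt_card_verts ⟨0, hn⟩

end width

/-! ### Layouts respecting the boxes -/

section spread

variable {n k : ℕ} {G : SimpleGraph (Fin n)} {r : Fin k → Fin n} {s : ℕ} {f : Fin n ≃ Fin n}

/-- In the layout `f`, vertices within distance two (three) of a root are at most two (three) boxes
of size `s` away from it. -/
def Spread (G : SimpleGraph (Fin n)) (r : Fin k → Fin n) (s : ℕ) (f : Fin n ≃ Fin n) : Prop :=
  ∀ a v,
    (G.edist (r a) v ≤ 2 → (f v : ℕ) / s ≤ f (r a) / s + 2 ∧ (f (r a) : ℕ) / s ≤ f v / s + 2) ∧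
    (G.edist (r a) v ≤ 3 → (f v : ℕ) / s ≤ f (r a) / s + 3 ∧ (f (r a) : ℕ) / s ≤ f v / s + 3)

/-- The pairs `v`, `f v` already form a perfect matching, so only their being edges of the auxiliary
graph is a condition. -/
theorem isMatchingLayout_iff {R : Set (Fin n)} {p : R → Fin (n ⌈/⌉ s)} :
    IsMatchingLayout G R s p f ↔
      ∀ v, ∃ i ∈ allowedBoxes G R p v, (i : ℕ) = (f v : ℕ) / s := by
  constructor
  · rintro ⟨M, _, hM⟩ v
    have h := (hM v).adj_sub
    rw [auxGraph, SimpleGraph.fromRel_adj] at h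
    obtain ⟨_, ⟨v', j, h1, h2, i, h3, h4⟩ | ⟨v', j, h1, h2, _⟩⟩ := h
    · cases h1; cases h2; exact ⟨i, h3, h4⟩
    · cases h1
  · intro h
    refine ⟨{ verts := Set.univ
              Adj := fun x y => ∃ v, (x = .inl v ∧ y = .inr (f v)) ∨ (y = .inl v ∧ x = .inr (f v))
              adj_sub := ?_
              edge_vert := fun _ => Set.mem_univ _
              symm := ⟨fun x y ⟨v, h⟩ => ⟨v, h.symm⟩⟩ }, ⟨?_, fun _ => Set.mem_univ _⟩,
      fun v => ⟨v, .inl ⟨rfl, rfl⟩⟩⟩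
    · rintro x y ⟨v, ⟨rfl, rfl⟩ | ⟨rfl, rfl⟩⟩
      · rw [auxGraph, SimpleGraph.fromRel_adj]
        exact ⟨by simp, .inl ⟨v, _, rfl, rfl, h v⟩⟩
      · rw [auxGraph, SimpleGraph.fromRel_adj]
        exact ⟨by simp, .inr ⟨v, _, rfl, rfl, h v⟩⟩
    · rintro (v | j) -
      · refine ⟨.inr (f v), ⟨v, .inl ⟨rfl, rfl⟩⟩, ?_⟩
        rintro y ⟨w, ⟨h1, rfl⟩ | ⟨_, h1⟩⟩
        · cases h1; rfl
        · cases h1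
      · refine ⟨.inl (f.symm j), ⟨f.symm j, .inr ⟨rfl, by simp⟩⟩, ?_⟩
        rintro y ⟨w, ⟨h1, _⟩ | ⟨rfl, h1⟩⟩
        · cases h1
        · cases h1; simp

/-- The placement can be eliminated: each root must stay in its own box, so `p` is forced to be the
box of `f` at that root. -/
theorem exists_isMatchingLayout_iff (hs : 0 < s) :
    (∃ p, IsMatchingLayout G (Set.range r) s p f) ↔ Spread G r s f := by
  simp only [isMatchingLayout_iff]
  constructor
  · rintro ⟨p, hp⟩ a v
    obtain ⟨i, ⟨h1, h2, h3⟩, h4⟩ := hp v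
    obtain ⟨j, ⟨h5, _, _⟩, h6⟩ := hp (r a)
    have h7 := h5 ⟨r a, a, rfl⟩ rfl
    have h2 := h2 ⟨r a, a, rfl⟩
    have h3 := h3 ⟨r a, a, rfl⟩
    rw [← h7] at h2 h3
    rw [← h4, ← h6]
    refine ⟨fun h => ?_, fun h => ?_⟩
    · have := abs_le.1 (h2 h); omega
    · have := abs_le.1 (h3 h); omega
  · intro h
    have hb : ∀ j : Fin n, (j : ℕ) / s < n ⌈/⌉ s := by
      intro j
      by_contra! hc
      have h1 : n ≤ s * (n ⌈/⌉ s) := le_smul_ceilDiv hs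
      have h2 : s * (n ⌈/⌉ s) ≤ s * ((j : ℕ) / s) := Nat.mul_le_mul_left _ hc
      have h3 := Nat.mul_div_le (j : ℕ) s
      have := j.2
      omega
    refine ⟨fun u => ⟨_, hb (f u)⟩, fun v => ⟨⟨_, hb (f v)⟩, ⟨?_, ?_, ?_⟩, rfl⟩⟩
    · rintro u rfl; rfl
    · rintro ⟨_, a, rfl⟩ hu
      have := (h a v).1 hu
      rw [abs_le]; simp only; omega
    · rintro ⟨_, a, rfl⟩ hu
      have := (h a v).2 hu
      rw [abs_le]; simp only; omega

theorem isResult_of_spread (hd : 0 < minDeg G) (h₁ : minDeg G ≤ s)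
    (h₂ : s ≤ max (minDeg G) (n / 2)) (hf : Spread G r s f)
    (h : ∀ s', minDeg G ≤ s' → s' < s → ∀ g, ¬ Spread G r s' g) :
    IsResult G (Set.range r) f :=
  ⟨s, h₁, h₂, (exists_isMatchingLayout_iff (hd.trans_le h₁)).2 hf, fun s' h3 h4 p g hg =>
    h s' h3 h4 g ((exists_isMatchingLayout_iff (hd.trans_le h3)).1 ⟨p, hg⟩)⟩

theorem spread_refl (h : n ≤ 3 * s) : Spread G r s (Equiv.refl _) := by
  have hb : ∀ j : Fin n, (j : ℕ) / s ≤ 2 := fun j =>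
    Nat.lt_succ_iff.1 (Nat.div_lt_of_lt_mul (by have := j.2; rw [Nat.mul_comm]; omega))
  intro a v
  have h1 := hb v
  have h2 := hb (r a)
  simp only [Equiv.refl_apply]
  generalize (v : ℕ) / s = x at *
  generalize (r a : ℕ) / s = y at *
  exact ⟨fun _ => ⟨by omega, by omega⟩, fun _ => ⟨by omega, by omega⟩⟩

theorem le_add_mul_of_edist_le {w : ℕ} (hw : width G f ≤ w) {h : ℕ} {u v : Fin n}
    (huv : G.edist u v ≤ h) : (f u : ℕ) ≤ f v + h * w := by
  obtain ⟨p, hp⟩ := SimpleGraph.exists_walk_of_edist_ne_top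
    (ne_top_of_le_ne_top (ENat.natCast_ne_top h) huv)
  rw [← hp, Nat.cast_le] at huv
  have key : ∀ {u v : Fin n} (p : G.Walk u v), (f u : ℕ) ≤ f v + p.length * w := by
    intro u v p
    induction p with
    | nil => simp
    | cons hadj p ih =>
      have := width_le_iff.1 hw _ _ hadj
      rw [SimpleGraph.Walk.length_cons, Nat.succ_mul]
      omega
  exact (key p).trans (Nat.add_le_add_left (Nat.mul_le_mul_right _ huv) _)

theorem spread_of_width_le (hs : 0 < s) (hw : width G f ≤ s) : Spread G r s f := by
  have key : ∀ (h : ℕ) (u v : Fin n), G.edist u v ≤ h → (f u : ℕ) / s ≤ f v / s + h := by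
    intro h u v huv
    have := Nat.div_le_div_right (c := s) (le_add_mul_of_edist_le hw huv)
    rwa [Nat.add_mul_div_right _ _ hs] at this
  intro a v
  refine ⟨fun h => ⟨?_, ?_⟩, fun h => ⟨?_, ?_⟩⟩
  · exact key 2 _ _ (by rw [SimpleGraph.edist_comm]; exact_mod_cast h)
  · exact key 2 _ _ (by exact_mod_cast h)
  · exact key 3 _ _ (by rw [SimpleGraph.edist_comm]; exact_mod_cast h)
  · exact key 3 _ _ (by exact_mod_cast h)

theorem width_le_of_spread (hs : 0 < s) (hf : Spread G r s f)
    (hr : IsHopDominating G 2 (Set.range r)) : width G f ≤ 6 * s := by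
  rw [width_le_iff]
  intro u v huv
  obtain ⟨_, ⟨a, rfl⟩, ha⟩ := hr v
  have h1 := ((hf a v).1 (by exact_mod_cast ha)).2
  have h2 : G.edist (r a) u ≤ 3 := by
    refine (G.edist_triangle (v := v)).trans ?_
    have : G.edist v u = 1 := SimpleGraph.edist_eq_one_iff_adj.2 huv.symm
    rw [this]
    calc G.edist (r a) v + 1 ≤ 2 + 1 := by gcongr; exact_mod_cast ha
      _ = 3 := by norm_num
  have h3 := ((hf a u).2 h2).1
  have h4 : (f u : ℕ) / s ≤ f v / s + 5 := by omega
  have h5 := Nat.lt_mul_div_succ (f u : ℕ) hs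
  have h6 := Nat.mul_div_le (f v : ℕ) s
  have h7 : s * ((f u : ℕ) / s + 1) ≤ s * (f v / s + 6) := Nat.mul_le_mul_left _ (by omega)
  simp only [Nat.mul_add] at h5 h7
  omega

/-- At the last box size there are at most three boxes, since `n ≤ 3 * (n / 2)` for `n ≥ 2` even
with rounding. All constraints are then void, so the search always succeeds. -/
theorem exists_spread (hn : 2 ≤ n) : ∃ f, Spread G r (max (minDeg G) (n / 2)) f :=
  ⟨_, spread_refl (by omega)⟩

/-- An optimal layout is spread for box size `bandwidth G`, which is at least `minDeg G`; were it
smaller than `s`, it would be one of the sizes that failed. -/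
theorem le_bandwidth_of_no_spread (hn : 0 < n) (hd : 0 < minDeg G)
    (h : ∀ s', minDeg G ≤ s' → s' < s → ∀ g, ¬ Spread G r s' g) : s ≤ bandwidth G := by
  obtain ⟨f, hf⟩ := exists_width_eq_bandwidth G
  by_contra! hlt
  have h1 : minDeg G ≤ bandwidth G := hf ▸ minDeg_le_width hn
  exact h _ h1 hlt f (spread_of_width_le (hd.trans_le h1) hf.le)

end spread

/-! ### The same on natural numbers -/

section numbers

variable {n k : ℕ}

/-- Adjacency of vertices given as natural numbers. -/
def AdjN (G : SimpleGraph (Fin n)) (u v : ℕ) : Prop :=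
  ∃ (hu : u < n) (hv : v < n), G.Adj ⟨u, hu⟩ ⟨v, hv⟩

/-- Distance at most `h`. -/
def Near (G : SimpleGraph (Fin n)) : ℕ → ℕ → ℕ → Prop
  | 0, u, v => u = v
  | h + 1, u, v => Near G h u v ∨ ∃ w < n, AdjN G u w ∧ Near G h w v

theorem near_iff (G : SimpleGraph (Fin n)) (h : ℕ) (u v : Fin n) :
    Near G h u v ↔ G.edist u v ≤ h := by
  induction h generalizing u with
  | zero =>
    rw [Near, Nat.cast_zero, nonpos_iff_eq_zero, SimpleGraph.edist_eq_zero_iff, Fin.ext_iff]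
  | succ h ih =>
    rw [Near, ih]
    constructor
    · rintro (h1 | ⟨w, hw, ⟨_, _, h1⟩, h2⟩)
      · exact h1.trans (by exact_mod_cast Nat.le_succ h)
      · have h2 := (ih ⟨w, hw⟩).1 h2
        refine (G.edist_triangle (v := ⟨w, hw⟩)).trans ?_
        have h3 : G.edist u ⟨w, hw⟩ = 1 := SimpleGraph.edist_eq_one_iff_adj.2 h1
        rw [h3, Nat.cast_succ, add_comm]
        gcongr
    · intro huv
      obtain ⟨p, hp⟩ := SimpleGraph.exists_walk_of_edist_ne_top
        (ne_top_of_le_ne_top (ENat.natCast_ne_top _) huv)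
      rw [← hp, Nat.cast_le] at huv
      cases p with
      | nil => left; simp
      | @cons _ w _ hadj p =>
        right
        refine ⟨w, w.2, ⟨u.2, w.2, hadj⟩, (ih w).2 ?_⟩
        rw [SimpleGraph.Walk.length_cons] at huv
        exact p.edist_le.trans (by exact_mod_cast Nat.le_of_succ_le_succ huv)

/-- Digit `a` of `t` in base `2 ^ c`. -/
def digit (c t a : ℕ) : ℕ := t / 2 ^ (c * a) % 2 ^ c

/-- The vertex `v` may be put at position `j` if root `a` is placed in the box `digit c t a`. -/
def Fits (G : SimpleGraph (Fin n)) (k : ℕ) (R : ℕ → ℕ) (c s t v j : ℕ) : Prop :=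
  ∀ a < k, (R a = v → j / s = digit c t a) ∧
    (Near G 2 (R a) v → j / s ≤ digit c t a + 2 ∧ digit c t a ≤ j / s + 2) ∧
    (Near G 3 (R a) v → j / s ≤ digit c t a + 3 ∧ digit c t a ≤ j / s + 3)

/-- Each constraint confines `j / s` to an interval, and `j / s` is monotone in `j`. This is what
makes the greedy matching correct. -/
theorem Fits.ordConnected {G : SimpleGraph (Fin n)} {R : ℕ → ℕ} {c s t v j₁ j j₂ : ℕ}
    (h₁ : Fits G k R c s t v j₁) (h₂ : Fits G k R c s t v j₂) (hj₁ : j₁ ≤ j) (hj₂ : j ≤ j₂) :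
    Fits G k R c s t v j := by
  intro a ha
  have h1 := h₁ a ha
  have h2 := h₂ a ha
  have e1 : j₁ / s ≤ j / s := Nat.div_le_div_right hj₁
  have e2 : j / s ≤ j₂ / s := Nat.div_le_div_right hj₂
  refine ⟨fun h => ?_, fun h => ?_, fun h => ?_⟩
  · have := h1.1 h; have := h2.1 h; omega
  · have := h1.2.1 h; have := h2.2.1 h; omega
  · have := h1.2.2 h; have := h2.2.2 h; omega

/-- Placements are numbers with `k` digits in base `2 ^ c`, and `hc` makes every box index a digit.
Digits beyond the last box do no harm, because each root must lie in the box named by its digit. -/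
theorem spread_iff_exists_fits {G : SimpleGraph (Fin n)} {r : Fin k → Fin n} {R : ℕ → ℕ} {c s : ℕ}
    (hR : ∀ a, R (a : Fin k) = r a) (hc : n ≤ s * 2 ^ c) (f : Fin n ≃ Fin n) :
    Spread G r s f ↔ ∃ t < 2 ^ (c * k), ∀ v : Fin n, Fits G k R c s t v (f v) := by
  constructor
  · intro h
    let q : Fin k → Fin (2 ^ c) := fun a => ⟨f (r a) / s,
      Nat.div_lt_of_lt_mul ((f (r a)).2.trans_le hc)⟩
    refine ⟨finFunctionFinEquiv q, (finFunctionFinEquiv q).2.trans_eq (pow_mul 2 c k).symm, ?_⟩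
    intro v a ha
    have hq : digit c (finFunctionFinEquiv q) a = f (r ⟨a, ha⟩) / s := by
      have := finFunctionFinEquiv_symm_apply_val (finFunctionFinEquiv q) ⟨a, ha⟩
      rw [Equiv.symm_apply_apply] at this
      rw [digit, pow_mul, ← this]
    rw [hq, hR ⟨a, ha⟩, near_iff, near_iff]
    exact ⟨fun e => by rw [Fin.ext e], fun e => (h ⟨a, ha⟩ v).1 (by exact_mod_cast e),
      fun e => (h ⟨a, ha⟩ v).2 (by exact_mod_cast e)⟩
  · rintro ⟨t, -, h⟩ a v
    have h1 := (h (r a) a a.2).1 (hR a)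
    have h2 := (h v a a.2).2
    rw [hR, near_iff, near_iff, ← h1] at h2
    exact ⟨fun e => h2.1 (by exact_mod_cast e), fun e => h2.2 (by exact_mod_cast e)⟩

end numbers

/-! ### Greedy matching for intervals -/

section greedy

/-- The vertex `v` is a best choice for position `j`, given the choices `σ` for the positions before
`j`: it is unused, allowed at `j`, and allowed at the least number of positions from `j` on. -/
def IsBest (n : ℕ) (P : ℕ → ℕ → Prop) (σ : ℕ → ℕ) (j v : ℕ) : Prop :=
  ((∀ i < j, σ i ≠ v) ∧ P v j) ∧ ∀ w < n, (∀ i < j, σ i ≠ w) ∧ P w j →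
    ∑ i ∈ Finset.range n, ind (j ≤ i ∧ P v i) ≤ ∑ i ∈ Finset.range n, ind (j ≤ i ∧ P w i)

variable {n : ℕ} {P : ℕ → ℕ → Prop} {σ : ℕ → ℕ}

theorem exists_best {S : ℕ → Prop} (F : ℕ → ℕ) (h : ∃ v < n, S v) :
    ∃ v < n, S v ∧ ∀ w < n, S w → F v ≤ F w := by
  classical
  obtain ⟨v, hv, hS⟩ := h
  obtain ⟨w, hw, hmin⟩ := Finset.exists_min_image ((Finset.range n).filter S) F ⟨v, by simp [*]⟩
  simp only [Finset.mem_filter, Finset.mem_range] at hw hmin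
  exact ⟨w, hw.1, hw.2, fun x hx hSx => hmin x ⟨hx, hSx⟩⟩

theorem exists_isBest {j : ℕ} (h : ∃ v < n, (∀ i < j, σ i ≠ v) ∧ P v j) :
    ∃ v < n, IsBest n P σ j v :=
  (exists_best (fun v => ∑ i ∈ Finset.range n, ind (j ≤ i ∧ P v i)) h).imp fun _ h => h

/-- For vertices allowed at `j`, the remaining positions form an interval starting at `j`, so
comparing counts compares right ends. -/
theorem allowed_of_count_le (hP : ∀ v a b c, P v a → P v c → a ≤ b → b ≤ c → P v b)
    {v w j j' : ℕ} (hw : P w j) (hv : P v j) (hv' : P v j') (hj : j ≤ j') (hj' : j' < n)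
    (h : ∑ i ∈ Finset.range n, ind (j ≤ i ∧ P v i) ≤ ∑ i ∈ Finset.range n, ind (j ≤ i ∧ P w i)) :
    P w j' := by
  by_contra hc
  refine absurd h (not_le.2 (Finset.sum_lt_sum (fun i _ => ?_) ⟨j', by simpa using hj', ?_⟩))
  · by_cases hi : j ≤ i ∧ P w i
    · have : P v i := by
        refine hP v j i j' hv hv' hi.1 ?_
        by_contra! hlt
        exact hc (hP w j j' i hw hi.2 hj hlt.le)
      rw [ind_true hi, ind_true ⟨hi.1, this⟩]
    · rw [ind_false hi]; exact Nat.zero_le _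
  · rw [ind_true (p := j ≤ j' ∧ P v j') ⟨hj, hv'⟩, ind_false fun h => hc h.2]
    exact Nat.one_pos

/-- A perfect matching of an interval structure can be completed after every greedy choice. -/
theorem greedy_extends (hP : ∀ v a b c, P v a → P v c → a ≤ b → b ≤ c → P v b)
    (hσ : ∀ j < n, (σ j < n ∧ IsBest n P σ j (σ j)) ∨ (σ j = n ∧ ∀ v < n, ¬ IsBest n P σ j v))
    (f : Fin n ≃ Fin n) (hf : ∀ v, P (v : Fin n) (f v)) :
    ∀ j ≤ n, ∃ g : Fin n ≃ Fin n, (∀ v, P (v : Fin n) (g v)) ∧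
      ∀ i : Fin n, (i : ℕ) < j → σ i = g.symm i := by
  intro j
  induction j with
  | zero => exact fun _ => ⟨f, hf, by simp⟩
  | succ j ih =>
    intro hj
    obtain ⟨g, hg, hgσ⟩ := ih (by omega)
    set J : Fin n := ⟨j, hj⟩ with hJ
    set w := g.symm J with hw
    have hgw : g w = J := by simp [hw]
    have hPw : P w j := by have := hg w; rwa [hgw] at this
    -- By induction `g` realises the choices before `j`, so the unused vertices are those that `g`
    -- puts at `j` or later.
    have hunused : ∀ v : Fin n, J ≤ g v → ∀ i < j, σ i ≠ v := by
      intro v hv i hi he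
      have h1 := hgσ ⟨i, hi.trans hj⟩ hi
      simp only at h1
      rw [he] at h1
      have h2 : v = g.symm ⟨i, hi.trans hj⟩ := Fin.ext h1
      rw [h2, Equiv.apply_symm_apply, hJ, Fin.mk_le_mk] at hv
      omega
    have hcand : ∃ v < n, (∀ i < j, σ i ≠ v) ∧ P v j :=
      ⟨w, w.2, hunused w hgw.ge, hPw⟩
    rcases hσ j hj with ⟨hlt, hbest⟩ | ⟨_, hnone⟩
    swap
    · obtain ⟨v, hv, hb⟩ := exists_isBest hcand
      exact absurd hb (hnone v hv)
    set v : Fin n := ⟨σ j, hlt⟩ with hv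
    have hPv : P v j := hbest.1.2
    have hle : J ≤ g v := by
      by_contra! hc
      have := hgσ (g v) hc
      rw [Equiv.symm_apply_apply] at this
      exact hbest.1.1 _ hc this
    have hPw' : P w (g v) :=
      allowed_of_count_le hP hPw hPv (hg v) hle (g v).2
        (hbest.2 w w.2 ⟨hunused w hgw.ge, hPw⟩)
    -- Exchange: the greedy choice `v` takes position `j`, and the previous occupant `w` moves to `g
    -- v`, which is open to it because the interval of `v` ends no later than that of `w`.
    refine ⟨(Equiv.swap v w).trans g, fun x => ?_, fun i hi => ?_⟩
    · rw [Equiv.trans_apply]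
      rcases eq_or_ne x v with rfl | hxv
      · rw [Equiv.swap_apply_left, hgw]; exact hPv
      · rcases eq_or_ne x w with hxw | hxw
        · rw [hxw, Equiv.swap_apply_right]; exact hPw'
        · rw [Equiv.swap_apply_of_ne_of_ne hxv hxw]; exact hg x
    · rw [Equiv.symm_trans_apply, Equiv.symm_swap]
      rcases Nat.lt_succ_iff_lt_or_eq.1 hi with hi | hi
      · rw [Equiv.swap_apply_of_ne_of_ne, hgσ i hi]
        · intro e
          rw [← e, Equiv.apply_symm_apply] at hle
          exact absurd hle (not_le.2 hi)
        · rw [hw]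
          intro e
          exact hi.ne (congrArg Fin.val (g.symm.injective e))
      · have : i = J := Fin.ext hi
        rw [this, ← hw, Equiv.swap_apply_right]

theorem greedy_lt (hP : ∀ v a b c, P v a → P v c → a ≤ b → b ≤ c → P v b)
    (hσ : ∀ j < n, (σ j < n ∧ IsBest n P σ j (σ j)) ∨ (σ j = n ∧ ∀ v < n, ¬ IsBest n P σ j v))
    (f : Fin n ≃ Fin n) (hf : ∀ v, P (v : Fin n) (f v)) : ∀ j < n, σ j < n := by
  obtain ⟨g, _, hg⟩ := greedy_extends hP hσ f hf n le_rfl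
  intro j hj
  rw [hg ⟨j, hj⟩ hj]
  exact Fin.is_lt _

theorem exists_equiv_of_greedy
    (hσ : ∀ j < n, (σ j < n ∧ IsBest n P σ j (σ j)) ∨ (σ j = n ∧ ∀ v < n, ¬ IsBest n P σ j v))
    (h : ∀ j < n, σ j < n) :
    ∃ f : Fin n ≃ Fin n, (∀ v, P (v : Fin n) (f v)) ∧ ∀ j : Fin n, σ j = f.symm j := by
  have hb : ∀ j < n, IsBest n P σ j (σ j) := fun j hj =>
    (hσ j hj).elim (fun h => h.2) fun h' => absurd h'.1 (h j hj).ne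
  let e : Fin n → Fin n := fun j => ⟨σ j, h j j.2⟩
  have he : Function.Injective e := by
    intro i j hij
    have hij : σ i = σ j := congrArg Fin.val hij
    rcases lt_trichotomy (i : ℕ) j with hlt | heq | hlt
    · exact absurd hij ((hb j j.2).1.1 i hlt)
    · exact Fin.ext heq
    · exact absurd hij.symm ((hb i i.2).1.1 j hlt)
  let E := Equiv.ofBijective e (Finite.injective_iff_bijective.1 he)
  refine ⟨E.symm, fun v => ?_, fun j => rfl⟩
  have h1 := (hb (E.symm v) (Fin.is_lt _)).1.2
  have h2 : σ (E.symm v) = v := congrArg Fin.val (E.apply_symm_apply v)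
  rwa [h2] at h1

end greedy

end DenseBandwidth

namespace DenseBandwidth

/-! ### Random roots -/

section counting

variable {n : ℕ}

/-- The fraction of `k`-tuples that avoid a set of density `δ`. -/
theorem card_avoiding_le {δ : ℝ} (k : ℕ) (S : Finset (Fin n)) (hS : δ * n ≤ S.card) :
    ((Finset.univ.filter fun r : Fin k → Fin n => ∀ i, r i ∉ S).card : ℝ) ≤
      (1 - δ) ^ k * n ^ k := by
  classical
  have h1 : (Finset.univ.filter fun r : Fin k → Fin n => ∀ i, r i ∉ S) =
      Fintype.piFinset fun _ => Sᶜ := by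
    ext r; simp [Fintype.mem_piFinset]
  have h2 : (Sᶜ.card : ℝ) ≤ (1 - δ) * n := by
    rw [Finset.card_compl, Fintype.card_fin, Nat.cast_sub (by simpa using S.card_le_univ)]
    linarith
  rw [h1, Fintype.card_piFinset, Finset.prod_const, Finset.card_univ, Fintype.card_fin,
    Nat.cast_pow, ← mul_pow]
  exact pow_le_pow_left₀ (Nat.cast_nonneg _) h2 k

/-- Union bound: the tuples that miss one of finitely many dense sets. -/
theorem card_missing_le {δ : ℝ} {ι : Type*} [Fintype ι] (k : ℕ) (S : ι → Finset (Fin n))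
    (hS : ∀ x, δ * n ≤ (S x).card) :
    ((Finset.univ.filter fun r : Fin k → Fin n => ∃ x, ∀ i, r i ∉ S x).card : ℝ) ≤
      Fintype.card ι * ((1 - δ) ^ k * n ^ k) := by
  classical
  have h1 : (Finset.univ.filter fun r : Fin k → Fin n => ∃ x, ∀ i, r i ∉ S x) ⊆
      Finset.univ.biUnion fun x => Finset.univ.filter fun r : Fin k → Fin n => ∀ i, r i ∉ S x := by
    intro r; simp
  calc ((Finset.univ.filter fun r : Fin k → Fin n => ∃ x, ∀ i, r i ∉ S x).card : ℝ)
      ≤ ∑ x, ((Finset.univ.filter fun r : Fin k → Fin n => ∀ i, r i ∉ S x).card : ℝ) := by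
        exact_mod_cast (Finset.card_le_card h1).trans Finset.card_biUnion_le
    _ ≤ ∑ _x : ι, ((1 - δ) ^ k * n ^ k) :=
        Finset.sum_le_sum fun x _ => card_avoiding_le k (S x) (hS x)
    _ = _ := by simp

variable {G : SimpleGraph (Fin n)}

/-- A dense graph has a dominating tuple of logarithmic length. -/
theorem exists_dominating {δ : ℝ} (hn : 0 < n) (hG : IsDense δ G) {k : ℕ}
    (hk : n * (1 - δ) ^ k < 1) : ∃ D : Fin k → Fin n, ∀ v, ∃ i, G.Adj v (D i) := by
  classical
  have h := card_missing_le k (fun v => G.neighborFinset v) (δ := δ) fun v => by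
    rw [G.card_neighborFinset_eq_degree]
    exact hG.trans (by exact_mod_cast minDeg_le_degree v)
  have h1 : (Finset.univ.filter fun r : Fin k → Fin n =>
      ∃ x, ∀ i, r i ∉ G.neighborFinset x).card < n ^ k := by
    have hpos : (0 : ℝ) < n ^ k := by positivity
    rw [Fintype.card_fin] at h
    have : (n : ℝ) * ((1 - δ) ^ k * n ^ k) < n ^ k := by nlinarith
    have h' := h.trans_lt this
    rw [← Nat.cast_pow, Nat.cast_lt] at h'
    convert h'
  by_contra! hc
  rw [Finset.filter_true_of_mem] at h1
  · simp at h1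
  · intro D _
    obtain ⟨v, hv⟩ := hc D
    exact ⟨v, fun i => by simpa using hv i⟩

/-- Few tuples fail to be 2-dominating. -/
theorem card_not_isHopDominating_le {δ : ℝ} (hn : 0 < n) (hG : IsDense δ G) {l k : ℕ}
    (hl : n * (1 - δ) ^ l < 1) :
    (((Set.univ : Set (Fin k → Fin n)) \ {r | IsHopDominating G 2 (Set.range r)}).ncard : ℝ) ≤
      l * ((1 - δ) ^ k * n ^ k) := by
  classical
  obtain ⟨D, hD⟩ := exists_dominating hn hG hl
  -- The union bound runs over the `l` members of `D` instead of the `n` vertices: a root adjacent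
  -- to `D j` is within distance 2 of everything `D j` dominates.
  have h := card_missing_le k (fun j : Fin l => G.neighborFinset (D j)) (δ := δ) fun j => by
    rw [G.card_neighborFinset_eq_degree]
    exact hG.trans (by exact_mod_cast minDeg_le_degree _)
  rw [Fintype.card_fin] at h
  refine le_trans ?_ h
  rw [Nat.cast_le, ← Set.ncard_coe_finset]
  refine Set.ncard_le_ncard ?_
  rintro r ⟨-, hr⟩
  by_contra hc
  refine hr fun v => ?_
  obtain ⟨j, hj⟩ := hD v
  simp only [Finset.coe_filter, Finset.mem_univ, true_and, Set.mem_ofPred_eq, not_exists,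
    not_forall, not_not, SimpleGraph.mem_neighborFinset] at hc
  obtain ⟨i, hi⟩ := hc j
  refine ⟨r i, ⟨i, rfl⟩, (G.edist_triangle (v := D j)).trans ?_⟩
  rw [SimpleGraph.edist_eq_one_iff_adj.2 hi.symm, SimpleGraph.edist_eq_one_iff_adj.2 hj.symm]
  norm_num

end counting

/-! ### The number of roots: failure probability, growth, number of placements. -/

section parameters

/-- The number of roots. -/
def rootCount (c b n : ℕ) : ℕ := c * (Nat.log 2 (Nat.log 2 n) + b)

theorem half_pow {δ : ℝ} (hδ : δ ≤ 1) {c : ℕ} (hc : 1 ≤ δ * c) : (1 - δ) ^ c ≤ 1 / 2 := by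
  have h1 : (1 - δ) ^ c ≤ Real.exp (-δ) ^ c :=
    pow_le_pow_left₀ (by linarith) (Real.one_sub_le_exp_neg δ) c
  rw [← Real.exp_nat_mul] at h1
  have h2 : Real.exp (c * -δ) ≤ Real.exp (-1) := Real.exp_le_exp.2 (by nlinarith)
  have h3 : Real.exp (-1) ≤ 1 / 2 := by
    rw [Real.exp_neg, one_div]
    exact inv_anti₀ (by norm_num) (by have := Real.add_one_le_exp 1; linarith)
  linarith

theorem pow_mul_le {δ : ℝ} (hδ : δ ≤ 1) {c : ℕ} (hc : 1 ≤ δ * c) (j : ℕ) :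
    (1 - δ) ^ (c * j) ≤ (1 / 2) ^ j := by
  rw [pow_mul]
  exact pow_le_pow_left₀ (pow_nonneg (by linarith) _) (half_pow hδ hc) j

/-- Every `c` draws halve the chance of missing a neighbourhood. So `c * (ℓ + 1)` vertices can
dominate, and `Nat.log 2 ℓ + b` halvings outweigh the union bound over them up to `2 * c / 2 ^ b`,
which `hb` keeps below `α`. -/
theorem card_not_isHopDominating_rootCount_le {n : ℕ} {G : SimpleGraph (Fin n)} {δ α : ℝ}
    (hn : 0 < n) (hG : IsDense δ G) (hδ : δ ≤ 1) {c b : ℕ} (hc : 1 ≤ δ * c)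
    (hb : 2 * c ≤ α * 2 ^ b) :
    (((Set.univ : Set (Fin (rootCount c b n) → Fin n)) \
      {r | IsHopDominating G 2 (Set.range r)}).ncard : ℝ) ≤ α * n ^ rootCount c b n := by
  set ℓ := Nat.log 2 n with hℓ
  have hl : n * (1 - δ) ^ (c * (ℓ + 1)) < 1 := by
    have h1 : (n : ℝ) < 2 ^ (ℓ + 1) := by exact_mod_cast Nat.lt_pow_succ_log_self (by norm_num) n
    have h2 := pow_mul_le hδ hc (ℓ + 1)
    have h3 : (0 : ℝ) < (1 / 2) ^ (ℓ + 1) := by positivity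
    calc n * (1 - δ) ^ (c * (ℓ + 1)) ≤ n * (1 / 2) ^ (ℓ + 1) := by gcongr
      _ < 2 ^ (ℓ + 1) * (1 / 2) ^ (ℓ + 1) := by gcongr
      _ = 1 := by rw [← mul_pow]; norm_num
  refine (card_not_isHopDominating_le hn hG hl).trans ?_
  have h1 : (ℓ + 1 : ℝ) ≤ 2 ^ (Nat.log 2 ℓ + 1) := by
    exact_mod_cast Nat.lt_pow_succ_log_self (by norm_num) ℓ
  have h2 := pow_mul_le hδ hc (Nat.log 2 ℓ + b)
  have h3 : (c * (ℓ + 1) : ℕ) * (1 - δ) ^ rootCount c b n ≤ α := by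
    calc ((c * (ℓ + 1) : ℕ) : ℝ) * (1 - δ) ^ rootCount c b n
        ≤ (c * 2 ^ (Nat.log 2 ℓ + 1)) * (1 / 2) ^ (Nat.log 2 ℓ + b) := by
          push_cast; gcongr; exact h2
      _ = 2 * c * (1 / 2) ^ b * (2 ^ Nat.log 2 ℓ * (1 / 2) ^ Nat.log 2 ℓ) := by ring
      _ = 2 * c * (1 / 2) ^ b := by rw [← mul_pow]; norm_num
      _ ≤ α * 2 ^ b * (1 / 2) ^ b := by gcongr
      _ = α := by rw [mul_assoc, ← mul_pow]; norm_num
  rw [← mul_assoc]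
  gcongr

theorem eventually_rootCount_le {δ : ℝ} (h0 : 0 < δ) {c : ℕ} (hc : c ≤ 2 / δ) (b : ℕ) :
    ∀ᶠ n : ℕ in atTop, (rootCount c b n : ℝ) ≤ 8 / δ * Real.log (Real.log n) := by
  have ht : Tendsto (fun n : ℕ => Real.log (Real.log n)) atTop atTop :=
    Real.tendsto_log_atTop.comp (Real.tendsto_log_atTop.comp tendsto_natCast_atTop_atTop)
  -- Each binary logarithm costs a factor 2 over the natural one, so the iterated one is at most `2
  -- * log log n + 2`. The first threshold absorbs `b + 2` into another `2 * log log n`, and `c ≤ 2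
  -- / δ` gives the constant `8 = 2 * 4`.
  filter_upwards [ht.eventually_ge_atTop ((b : ℝ) + 1), eventually_ge_atTop 4] with n hn hn4
  have hlog2 : (1 / 2 : ℝ) < Real.log 2 := by have := Real.log_two_gt_d9; linarith
  have hle : ∀ x : ℕ, 2 * x ≥ 2 → (Nat.log 2 x : ℝ) ≤ 2 * Real.log x := by
    intro x hx
    have h1 : (2 : ℝ) ^ Nat.log 2 x ≤ x := by exact_mod_cast Nat.pow_log_le_self 2 (by omega)
    have h2 := Real.log_le_log (by positivity) h1
    rw [Real.log_pow] at h2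
    have : (0 : ℝ) ≤ Nat.log 2 x := by positivity
    nlinarith
  have hℓ : 2 ≤ Nat.log 2 n := Nat.le_log_of_pow_le (by norm_num) hn4
  have h1 := hle n (by omega)
  have h2 := hle (Nat.log 2 n) (by omega)
  have hpos : 0 < Real.log n := Real.log_pos (by exact_mod_cast (by omega : 1 < n))
  have h3 : Real.log (Nat.log 2 n) ≤ Real.log (Real.log n) + 1 := by
    have h4 := Real.log_le_log (by positivity) h1
    rw [Real.log_mul (by norm_num) hpos.ne'] at h4
    have := Real.log_two_lt_d9
    linarith
  have h5 : (Nat.log 2 (Nat.log 2 n) : ℝ) + b ≤ 4 * Real.log (Real.log n) := by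
    have : (0 : ℝ) ≤ b := by positivity
    linarith
  calc (rootCount c b n : ℝ) = c * ((Nat.log 2 (Nat.log 2 n) : ℝ) + b) := by
        simp [rootCount]
    _ ≤ 2 / δ * (4 * Real.log (Real.log n)) := by gcongr
    _ = _ := by ring

/-- The number of placements is polynomial: raising 2 to a multiple of the iterated logarithm gives
only a power of `log n`, here bounded crudely by a power of `n + 1`. -/
theorem two_pow_mul_rootCount_le (c b n : ℕ) :
    2 ^ (c * rootCount c b n) ≤ (n + 1) ^ (c * c) * 2 ^ (c * c * b) := by
  have h : 2 ^ Nat.log 2 (Nat.log 2 n) ≤ n + 1 := by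
    rcases Nat.eq_zero_or_pos (Nat.log 2 n) with h | h
    · simp [h]
    · exact (Nat.pow_log_le_self 2 h.ne').trans ((Nat.log_le_self 2 n).trans (Nat.le_succ n))
  calc 2 ^ (c * rootCount c b n) = (2 ^ Nat.log 2 (Nat.log 2 n)) ^ (c * c) * 2 ^ (c * c * b) := by
        rw [rootCount, ← pow_mul, ← pow_add]; ring_nf
    _ ≤ _ := Nat.mul_le_mul_right _ (Nat.pow_le_pow_left h _)

end parameters

/-! ### The loop that draws the roots -/

section draw

/-- Uniform tuples are drawn entry by entry. -/
theorem uniform_bind_snoc (n k : ℕ) [NeZero n] :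
    ((PMF.uniformOfFintype (Fin k → Fin n)).bind fun r =>
      (PMF.uniformOfFintype (Fin n)).map fun i => (Fin.snoc r i : Fin (k + 1) → Fin n)) =
    PMF.uniformOfFintype (Fin (k + 1) → Fin n) := by
  classical
  ext r
  rw [PMF.bind_apply, tsum_fintype, Finset.sum_eq_single (Fin.init r)]
  · rw [PMF.map_apply, tsum_fintype, Finset.sum_eq_single (r (Fin.last k))]
    · rw [if_pos (Fin.snoc_init_self r).symm]
      simp only [PMF.uniformOfFintype_apply, Fintype.card_pi, Fintype.card_fin, Finset.prod_const,
        Finset.card_univ, Nat.cast_pow]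
      rw [← ENNReal.mul_inv (by simp) (by simp), pow_succ]
    · intro i _ hi
      rw [if_neg]
      intro h
      have := congrFun h (Fin.last k)
      simp only [Fin.snoc_last] at this
      exact hi this.symm
    · simp
  · intro r' _ hr
    rw [mul_eq_zero]
    right
    rw [PMF.map_apply, tsum_fintype]
    refine Finset.sum_eq_zero fun i _ => if_neg ?_
    rintro rfl
    simp at hr
  · simp

theorem uniformBelow_eq (n : ℕ) [NeZero n] :
    uniformBelow n = (PMF.uniformOfFintype (Fin n)).map fun i : Fin n => (i : ℕ) := by
  obtain ⟨k, rfl⟩ := Nat.exists_eq_succ_of_ne_zero (NeZero.ne n)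
  exact PMF.map_id _

/-- Code drawing as many roots as the variable `1` says. -/
def drawRoots : Cmd := .loop 3 (.var 1) (.seq (.rand 4 (.var 0)) (.put 2 (.var 3) (.var 4)))

/-- All randomness is isolated in a uniform tuple, with the memory a function `F` of it. Restoring
the arrays inside `Agree` makes that clause speak of variables only. -/
theorem drawRoots_run {X n k : ℕ} [NeZero n] (hX : 2 ≤ X) (hk : k ≤ X) {m : Mem}
    (h0 : m.var 0 = n) (h1 : m.var 1 = k) :
    ∃ F : (Fin k → Fin n) → Mem × ℕ,
      drawRoots.run m = (PMF.uniformOfFintype (Fin k → Fin n)).map F ∧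
      ∀ r, Agree 3 m { (F r).1 with arr := m.arr } ∧ (F r).2 ≤ X ^ drawRoots.deg ∧
        (∀ a ≠ 2, (F r).1.arr a = m.arr a) ∧ ∀ i : Fin k, (F r).1.arr 2 i = r i := by
  have key : ∀ N, ∃ F : (Fin N → Fin n) → Mem × ℕ,
      (Nat.rec (PMF.pure (m, 2)) (fun k r => r.bind fun o₁ =>
          ((Cmd.seq (.rand 4 (.var 0)) (.put 2 (.var 3) (.var 4))).run (o₁.1.setVar 3 k)).map
            fun o₂ => (o₂.1, o₁.2 + o₂.2 + 1)) N : PMF (Mem × ℕ)) =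
        (PMF.uniformOfFintype (Fin N → Fin n)).map F ∧
      ∀ r, Agree 3 m { (F r).1 with arr := m.arr } ∧ (F r).2 = 2 + N * 6 ∧
        (∀ a ≠ 2, (F r).1.arr a = m.arr a) ∧ ∀ i : Fin N, (F r).1.arr 2 i = r i := by
    intro N
    induction N with
    | zero =>
      refine ⟨fun _ => (m, 2), ?_, fun r => ⟨Agree.refl _ _, rfl, fun _ _ => rfl, fun i => i.elim0⟩⟩
      rw [show (fun _ : Fin 0 → Fin n => (m, 2)) = Function.const _ (m, 2) from rfl, PMF.map_const]
      rfl
    | succ N ih =>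
      obtain ⟨F, hF, hr⟩ := ih
      let E : Mem × ℕ → ℕ → Mem × ℕ := fun o i =>
        ((((o.1.setVar 3 N).setVar 4 i).setArr 2 N i), o.2 + 5 + 1)
      refine ⟨fun r => E (F (Fin.init r)) (r (Fin.last N)), ?_, fun r => ?_⟩
      · have hb : ∀ r : Fin N → Fin n,
            ((Cmd.seq (.rand 4 (.var 0)) (.put 2 (.var 3) (.var 4))).run
              ((F r).1.setVar 3 N)).map (fun o₂ => (o₂.1, (F r).2 + o₂.2 + 1)) =
            (PMF.uniformOfFintype (Fin n)).map fun i : Fin n => E (F r) i := by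
          intro r
          have hv : ((F r).1.setVar 3 N).var 0 = n := by
            rw [setVar_var_ne _ _ (by norm_num), ← h0]; exact (hr r).1.1 0 (by norm_num)
          simp only [Cmd.run, Expr.eval, hv, uniformBelow_eq, PMF.map_bind, PMF.bind_map,
            PMF.map_comp, PMF.pure_map]
          rw [← PMF.bind_pure_comp]
          refine congrArg _ (funext fun i => ?_)
          simp only [Function.comp_apply, PMF.pure_map, E, setVar_var_self,
            setVar_var_ne _ _ (show 3 ≠ 4 by norm_num), Expr.cost]
        simp only [hF, PMF.bind_map]
        rw [← uniform_bind_snoc, PMF.map_bind]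
        refine congrArg _ (funext fun r => ?_)
        rw [Function.comp_apply, hb, PMF.map_comp]
        refine congrArg (PMF.map · _) (funext fun i => ?_)
        simp
      · obtain ⟨h2, h3, h4, h5⟩ := hr (Fin.init r)
        refine ⟨⟨fun z hz => ?_, rfl⟩, ?_, fun a ha => ?_, fun i => ?_⟩
        · have := h2.1 z hz
          simp only [E, setArr_var] at this ⊢
          rw [setVar_var_ne _ _ (by omega), setVar_var_ne _ _ (by omega), this]
        · simp only [E]; rw [h3]; ring
        · simp only [E]
          rw [setArr_arr_ne _ _ _ ha]
          exact h4 a ha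
        · simp only [E]
          rw [setArr_arr_self]
          refine Fin.lastCases ?_ (fun i => ?_) i
          · simp
          · rw [Fin.val_castSucc, Function.update_of_ne i.2.ne]
            exact h5 i
  obtain ⟨F, hF, hr⟩ := key k
  refine ⟨F, ?_, fun r => ⟨(hr r).1, ?_, (hr r).2.2⟩⟩
  · rw [← hF]
    simp only [drawRoots]
    rw [Cmd.run]
    simp only [Expr.eval, h1]
    rfl
  · rw [(hr r).2.1]
    refine le_trans ?_ (loop_cost_le (a := (Cmd.seq (.rand 4 (.var 0))
      (.put 2 (.var 3) (.var 4))).deg) (c := 1) hX hk)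
    -- The loop body has exponent `2 + 3 + 1 = 6`.
    have : 2 ^ 6 ≤ X ^ (Cmd.seq (.rand 4 (.var 0)) (.put 2 (.var 3) (.var 4))).deg :=
      Nat.pow_le_pow_left hX 6
    have h6 : k * 6 ≤ k * (X ^ (Cmd.seq (.rand 4 (.var 0)) (.put 2 (.var 3) (.var 4))).deg + 1) :=
      Nat.mul_le_mul_left _ (by omega)
    omega

end draw

end DenseBandwidth

namespace DenseBandwidth

/-! ### The terms of the algorithm -/

namespace Tm

def adj (u v : Tm) : Tm := get 0 (add (mul u (var 0)) v)
def minDeg : Tm := sum (var 0) fun d => all (var 0) fun v => lt d (sum (var 0) fun w => adj v w)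
def near : ℕ → Tm → Tm → Tm
  | 0, u, v => eq u v
  | h + 1, u, v => or (near h u v) (ex (var 0) fun w => and (adj u w) (near h w v))
def rootCount (c b : ℕ) : Tm := mul (const c) (add (log2 (log2 (var 0))) (const b))
def digit (c : ℕ) (t a : Tm) : Tm := mod (div t (pow2 (mul (const c) a))) (pow2 (const c))
def within (h : ℕ) (x y : Tm) : Tm := and (le x (add y (const h))) (le y (add x (const h)))
def fits (c : ℕ) (s t v j : Tm) : Tm := all (var 1) fun a =>
  and (imp (eq (get 2 a) v) (eq (div j s) (digit c t a)))
    (and (imp (near 2 (get 2 a) v) (within 2 (div j s) (digit c t a)))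
      (imp (near 3 (get 2 a) v) (within 3 (div j s) (digit c t a))))
def candidate (c : ℕ) (s t j v : Tm) : Tm :=
  and (all j fun i => not (eq (get 3 i) v)) (fits c s t v j)
def count (c : ℕ) (s t j v : Tm) : Tm := sum (var 0) fun i => and (le j i) (fits c s t v i)
def best (c : ℕ) (s t j v : Tm) : Tm :=
  and (candidate c s t j v)
    (all (var 0) fun w => imp (candidate c s t j w) (le (count c s t j v) (count c s t j w)))
def choose (c : ℕ) (s t j : Tm) : Tm := find (var 0) fun v => best c s t j v

end Tm

/-- The memory holds the graph, the number of roots and the array `R` of roots. -/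
structure Base {n : ℕ} (G : SimpleGraph (Fin n)) (k : ℕ) (R : ℕ → ℕ) (d : ℕ) (m : Mem) : Prop where
  two_le : 2 ≤ d
  var_zero : m.var 0 = n
  var_one : m.var 1 = k
  arr_zero : m.arr 0 = (input G).arr 0
  arr_two : m.arr 2 = R

/-- All loops of the algorithm are bounded by `X`. -/
structure Bounds (X n k c : ℕ) : Prop where
  two_le : 2 ≤ X
  n_le : n + 2 ≤ X
  k_le : k ≤ X
  c_le : c ≤ X
  pow_le : 2 ^ (c * k) ≤ X

/-! ### Values of the algorithm's terms. -/

section terms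

variable {n k c d X : ℕ} {G : SimpleGraph (Fin n)} {R : ℕ → ℕ} {m m₁ : Mem}

theorem Base.mono {d₁ : ℕ} (h : Base G k R d m) (hd : d ≤ d₁) (hm : Agree d m m₁) :
    Base G k R d₁ m₁ :=
  have := h.two_le
  ⟨this.trans hd, by rw [hm.1 0 (by omega), h.var_zero], by rw [hm.1 1 (by omega), h.var_one],
    by rw [hm.2, h.arr_zero], by rw [hm.2, h.arr_two]⟩

theorem Base.ev_n (h : Base G k R d m) (hX : 2 ≤ X) : Ev X (Tm.var 0) d m n :=
  (Ev.var hX (by have := h.two_le; omega)).of_eq h.var_zero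

theorem Base.ev_k (h : Base G k R d m) (hX : 2 ≤ X) : Ev X (Tm.var 1) d m k :=
  (Ev.var hX (by have := h.two_le; omega)).of_eq h.var_one

theorem input_arr_zero (G : SimpleGraph (Fin n)) {u v : ℕ} (hu : u < n) (hv : v < n) :
    (input G).arr 0 (u * n + v) = ind (AdjN G u v) := by
  classical
  unfold input ind
  refine if_congr ?_ rfl rfl
  simp only [true_and]
  constructor
  · rintro ⟨u', v', h1, h2⟩
    have e1 := congrArg (· / n) h2
    have e2 := congrArg (· % n) h2
    simp only [Nat.add_comm _ v, Nat.add_comm _ (v' : ℕ)] at e1 e2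
    rw [Nat.add_mul_div_right _ _ (by omega), Nat.add_mul_div_right _ _ (by omega),
      Nat.div_eq_of_lt hv, Nat.div_eq_of_lt v'.2, Nat.zero_add, Nat.zero_add] at e1
    rw [Nat.add_mul_mod_self_right, Nat.add_mul_mod_self_right, Nat.mod_eq_of_lt hv,
      Nat.mod_eq_of_lt v'.2] at e2
    subst e1 e2
    exact ⟨hu, hv, h1⟩
  · rintro ⟨hu, hv, h⟩
    exact ⟨_, _, h, rfl⟩

theorem Base.ev_adj (h : Base G k R d m) (hX : Bounds X n k c) {s t : Tm} {u v : ℕ}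
    (hs : Ev X s d m u) (ht : Ev X t d m v) (hu : u < n) (hv : v < n) :
    Ev X (Tm.adj s t) d m (ind (AdjN G u v)) := by
  have h2 := hX.two_le
  have := hX.n_le
  refine (Ev.get h2 0 (Ev.add h2 (Ev.mul h2 hs (h.ev_n h2) (by omega)) ht)).of_eq ?_
  rw [h.arr_zero, input_arr_zero G hu hv]

theorem sum_ind_adj [DecidableRel G.Adj] (v : Fin n) :
    ∑ w ∈ Finset.range n, ind (AdjN G v w) = G.degree v := by
  rw [Finset.sum_range, ← G.card_neighborFinset_eq_degree, Finset.card_eq_sum_ones,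
    ← Finset.sum_filter_add_sum_filter_not Finset.univ (G.Adj v),
    Finset.sum_congr rfl (g := fun _ => 1),
    Finset.sum_eq_zero (s := Finset.univ.filter fun w => ¬ G.Adj v w), add_zero]
  · refine Finset.sum_congr ?_ fun _ _ => rfl
    ext w; simp
  · intro w hw
    refine ind_false ?_
    rintro ⟨_, _, h⟩
    exact (Finset.mem_filter.1 hw).2 h
  · intro w hw
    exact ind_true ⟨v.2, w.2, (Finset.mem_filter.1 hw).2⟩

/-- `Tm.minDeg` counts the numbers below all degrees; counting up to `n` suffices because the
minimum degree is smaller than `n`. -/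
theorem lt_minDeg_iff (hn : 0 < n) (j : ℕ) :
    (∀ v < n, j < ∑ w ∈ Finset.range n, ind (AdjN G v w)) ↔ j < minDeg G := by
  classical
  constructor
  · intro h
    have : Nonempty (Fin n) := ⟨⟨0, hn⟩⟩
    obtain ⟨v, hv⟩ := G.exists_minimal_degree_vertex
    have h1 := h v v.2
    rw [sum_ind_adj] at h1
    unfold minDeg
    convert h1
  · intro h v hv
    exact (h.trans_le (minDeg_le_degree ⟨v, hv⟩)).trans_eq (sum_ind_adj ⟨v, hv⟩).symm

theorem Base.ev_minDeg (h : Base G k R d m) (hX : Bounds X n k c) (hn : 0 < n) :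
    Ev X Tm.minDeg d m (minDeg G) := by
  have h2 := hX.two_le
  have hle := hX.n_le
  refine (Ev.sum h2 (h.ev_n h2) (by omega) fun d₁ hd₁ m₁ hm₁ j hj x hx =>
    have h₁ := h.mono hd₁ hm₁
    Ev.all h2 (h₁.ev_n h2) (by omega) fun d₂ hd₂ m₂ hm₂ v hv y hy =>
      have h₂ := h₁.mono hd₂ hm₂
      Ev.lt h2 (hx.mono hd₂ hm₂) (Ev.sum h2 (h₂.ev_n h2) (by omega)
        fun d₃ hd₃ m₃ hm₃ w hw z hz =>
          (h₂.mono hd₃ hm₃).ev_adj hX (hy.mono hd₃ hm₃) hz hv hw)).of_eq ?_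
  exact sum_ind_eq (minDeg_lt hn).le fun j _ => lt_minDeg_iff hn j

theorem Base.ev_near (hX : Bounds X n k c) (r : ℕ) : ∀ {d : ℕ} {m : Mem}, Base G k R d m →
    ∀ {s t : Tm} {u v : ℕ}, Ev X s d m u → Ev X t d m v → u < n →
    Ev X (Tm.near r s t) d m (ind (Near G r u v)) := by
  have h2 := hX.two_le
  have hle := hX.n_le
  induction r with
  | zero => exact fun _ _ _ _ _ hs ht _ => Ev.eq h2 hs ht
  | succ r ih =>
    intro d m h s t u v hs ht hu
    exact Ev.or h2 (ih h hs ht hu) (Ev.ex h2 (h.ev_n h2) (by omega) fun d₁ hd₁ m₁ hm₁ w hw x hx =>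
      have h₁ := h.mono hd₁ hm₁
      Ev.and h2 (h₁.ev_adj hX (hs.mono hd₁ hm₁) hx hu hw) (ih h₁ hx (ht.mono hd₁ hm₁) hw))

theorem ev_digit (hX : Bounds X n k c) {t a : Tm} {u v : ℕ} (ht : Ev X t d m u)
    (ha : Ev X a d m v) (hu : u ≤ X) (hv : v < k) :
    Ev X (Tm.digit c t a) d m (digit c u v) := by
  have h2 := hX.two_le
  -- The loop computing `2 ^ (c * v)` is bounded through `c * k < 2 ^ (c * k) ≤ X`.
  have hcv : c * v ≤ X :=
    (Nat.mul_le_mul_left c hv.le).trans (Nat.lt_two_pow_self.le.trans hX.pow_le)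
  exact Ev.mod h2 (Ev.div h2 ht (Ev.pow2 h2 (Ev.mul h2 (Ev.const h2 c) ha hX.c_le) hcv) hu
    (by positivity)) (Ev.pow2 h2 (Ev.const h2 c) hX.c_le) ((Nat.div_le_self _ _).trans hu)
    (by positivity)

theorem ev_within (hX : 2 ≤ X) (h : ℕ) {x y : Tm} {u v : ℕ} (hx : Ev X x d m u)
    (hy : Ev X y d m v) : Ev X (Tm.within h x y) d m (ind (u ≤ v + h ∧ v ≤ u + h)) :=
  Ev.and hX (Ev.le hX hx (Ev.add hX hy (Ev.const hX h)))
    (Ev.le hX hy (Ev.add hX hx (Ev.const hX h)))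

variable {s t v j : Tm} {s' t' v' j' : ℕ}

theorem Base.ev_fits (h : Base G k R d m) (hX : Bounds X n k c) (hR : ∀ a < k, R a < n)
    (hs : Ev X s d m s') (ht : Ev X t d m t') (hv : Ev X v d m v') (hj : Ev X j d m j')
    (hs' : 0 < s') (ht' : t' ≤ X) (hj' : j' < n) :
    Ev X (Tm.fits c s t v j) d m (ind (Fits G k R c s' t' v' j')) := by
  have h2 := hX.two_le
  have hle := hX.n_le
  refine Ev.all h2 (h.ev_k h2) hX.k_le fun d₁ hd₁ m₁ hm₁ a ha x hx => ?_
  have h₁ := h.mono hd₁ hm₁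
  have hr : Ev X (Tm.get 2 x) d₁ m₁ (R a) := (Ev.get h2 2 hx).of_eq (by rw [h₁.arr_two])
  have hq := ev_digit hX (ht.mono hd₁ hm₁) hx ht' ha
  have hb := Ev.div h2 (hj.mono hd₁ hm₁) (hs.mono hd₁ hm₁) (by omega) hs'
  have hv := hv.mono hd₁ hm₁
  exact Ev.and h2 (Ev.imp h2 (Ev.eq h2 hr hv) (Ev.eq h2 hb hq))
    (Ev.and h2 (Ev.imp h2 (Base.ev_near hX 2 h₁ hr hv (hR a ha)) (ev_within h2 2 hb hq))
      (Ev.imp h2 (Base.ev_near hX 3 h₁ hr hv (hR a ha)) (ev_within h2 3 hb hq)))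

theorem Base.ev_candidate (h : Base G k R d m) (hX : Bounds X n k c) (hR : ∀ a < k, R a < n)
    (hs : Ev X s d m s') (ht : Ev X t d m t') (hv : Ev X v d m v') (hj : Ev X j d m j')
    (hs' : 0 < s') (ht' : t' ≤ X) (hj' : j' < n) :
    Ev X (Tm.candidate c s t j v) d m
      (ind ((∀ i < j', m.arr 3 i ≠ v') ∧ Fits G k R c s' t' v' j')) := by
  have h2 := hX.two_le
  have hle := hX.n_le
  exact Ev.and h2 (Ev.all h2 hj (by omega) fun d₁ hd₁ m₁ hm₁ i hi x hx =>
    Ev.not h2 (Ev.eq h2 ((Ev.get h2 3 hx).of_eq (by rw [hm₁.2])) (hv.mono hd₁ hm₁)))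
    (h.ev_fits hX hR hs ht hv hj hs' ht' hj')

theorem Base.ev_count (h : Base G k R d m) (hX : Bounds X n k c) (hR : ∀ a < k, R a < n)
    (hs : Ev X s d m s') (ht : Ev X t d m t') (hv : Ev X v d m v') (hj : Ev X j d m j')
    (hs' : 0 < s') (ht' : t' ≤ X) :
    Ev X (Tm.count c s t j v) d m
      (∑ i ∈ Finset.range n, ind (j' ≤ i ∧ Fits G k R c s' t' v' i)) := by
  have h2 := hX.two_le
  have hle := hX.n_le
  exact Ev.sum h2 (h.ev_n h2) (by omega) fun d₁ hd₁ m₁ hm₁ i hi x hx =>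
    Ev.and h2 (Ev.le h2 (hj.mono hd₁ hm₁) hx) ((h.mono hd₁ hm₁).ev_fits hX hR (hs.mono hd₁ hm₁)
      (ht.mono hd₁ hm₁) (hv.mono hd₁ hm₁) hx hs' ht' hi)

theorem Base.ev_best (h : Base G k R d m) (hX : Bounds X n k c) (hR : ∀ a < k, R a < n)
    (hs : Ev X s d m s') (ht : Ev X t d m t') (hv : Ev X v d m v') (hj : Ev X j d m j')
    (hs' : 0 < s') (ht' : t' ≤ X) (hj' : j' < n) :
    Ev X (Tm.best c s t j v) d m (ind (IsBest n (Fits G k R c s' t') (m.arr 3) j' v')) := by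
  have h2 := hX.two_le
  have hle := hX.n_le
  refine Ev.and h2 (h.ev_candidate hX hR hs ht hv hj hs' ht' hj') (Ev.all h2 (h.ev_n h2) (by omega)
    fun d₁ hd₁ m₁ hm₁ w hw x hx => ?_)
  have h₁ := h.mono hd₁ hm₁
  have hs := hs.mono hd₁ hm₁
  have ht := ht.mono hd₁ hm₁
  have hv := hv.mono hd₁ hm₁
  have hj := hj.mono hd₁ hm₁
  rw [← hm₁.2]
  exact Ev.imp h2 (h₁.ev_candidate hX hR hs ht hx hj hs' ht' hj')
    (Ev.le h2 (h₁.ev_count hX hR hs ht hv hj hs' ht') (h₁.ev_count hX hR hs ht hx hj hs' ht'))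

theorem Base.ev_choose (h : Base G k R d m) (hX : Bounds X n k c) (hR : ∀ a < k, R a < n)
    (hs : Ev X s d m s') (ht : Ev X t d m t') (hj : Ev X j d m j')
    (hs' : 0 < s') (ht' : t' ≤ X) (hj' : j' < n) :
    ∃ v, Ev X (Tm.choose c s t j) d m v ∧
      ((v < n ∧ IsBest n (Fits G k R c s' t') (m.arr 3) j' v) ∨
        (v = n ∧ ∀ w < n, ¬ IsBest n (Fits G k R c s' t') (m.arr 3) j' w)) := by
  have h2 := hX.two_le
  have hle := hX.n_le
  refine Ev.find h2 (h.ev_n h2) (by omega) fun d₁ hd₁ m₁ hm₁ w hw x hx => ?_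
  rw [← hm₁.2]
  exact (h.mono hd₁ hm₁).ev_best hX hR (hs.mono hd₁ hm₁) (ht.mono hd₁ hm₁) hx (hj.mono hd₁ hm₁)
    hs' ht' hj'

end terms

/-! ### The program -/

/-- Greedy matching for box size `minDeg + x` (variable `3`) and placement `t` (variable `4`). The
array `3` receives the vertices by position; upon success they are copied to the array `1`, and the
variable `2` is set. -/
def attempt (c : ℕ) : Cmd :=
  .seq (.loop 5 (.var 0) (.seq
    (Tm.choose c (Tm.add Tm.minDeg (Tm.var 3)) (Tm.var 4) (Tm.var 5) 6) (.put 3 (.var 5) (.var 6))))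
  (.seq (Tm.all (Tm.var 0) (fun j => Tm.lt (Tm.get 3 j) (Tm.var 0)) 6)
    (.ite (.var 6)
      (.seq (.loop 5 (.var 0) (.put 1 (.get 3 (.var 5)) (.var 5))) (.set 2 (.const 1))) .skip))

/-- Search through all box sizes and placements until the first success. -/
def search (c : ℕ) : Cmd :=
  .seq (Tm.add (Tm.const 1) (Tm.sub (Tm.div (Tm.var 0) (Tm.const 2)) Tm.minDeg) 6)
    (.loop 3 (.var 6) (.seq (Tm.pow2 (Tm.mul (Tm.const c) (Tm.var 1)) 6)
      (.loop 4 (.var 6) (.ite (.var 2) .skip (attempt c)))))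

/-- The whole algorithm. -/
def algorithm (c b : ℕ) : Cmd :=
  .seq (.seq (Tm.rootCount c b 6) (.set 1 (.var 6))) (.seq drawRoots (search c))

section program

variable {n k c X : ℕ} {G : SimpleGraph (Fin n)} {R : ℕ → ℕ}

theorem Base.setVar {m : Mem} (h : Base G k R 6 m) {x : ℕ} (hx : 2 ≤ x) (v : ℕ) :
    Base G k R 6 (m.setVar x v) :=
  ⟨h.two_le, by rw [setVar_var_ne _ _ (by omega), h.var_zero],
    by rw [setVar_var_ne _ _ (by omega), h.var_one], h.arr_zero, h.arr_two⟩

theorem Base.setArr {m : Mem} (h : Base G k R 6 m) {a : ℕ} (h0 : a ≠ 0) (h2 : a ≠ 2) (i v : ℕ) :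
    Base G k R 6 (m.setArr a i v) :=
  ⟨h.two_le, h.var_zero, h.var_one, by rw [setArr_arr_ne _ _ _ h0.symm, h.arr_zero],
    by rw [setArr_arr_ne _ _ _ h2.symm, h.arr_two]⟩

/-- A choice looks only at earlier entries, so later writes to the array, and entries left over from
earlier placements, do not affect it. -/
theorem IsBest.congr {P : ℕ → ℕ → Prop} {σ τ : ℕ → ℕ} {j v : ℕ} (h : ∀ i < j, σ i = τ i) :
    IsBest n P σ j v ↔ IsBest n P τ j v := by
  have : ∀ w, (∀ i < j, σ i ≠ w) ↔ ∀ i < j, τ i ≠ w := fun w =>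
    forall_congr' fun i => forall_congr' fun hi => by rw [h i hi]
  simp only [IsBest, this]

/-- The choice `σ j` is the greedy one. -/
def IsChoice (n : ℕ) (P : ℕ → ℕ → Prop) (σ : ℕ → ℕ) (j : ℕ) : Prop :=
  (σ j < n ∧ IsBest n P σ j (σ j)) ∨ (σ j = n ∧ ∀ v < n, ¬ IsBest n P σ j v)

theorem IsChoice.congr {P : ℕ → ℕ → Prop} {σ τ : ℕ → ℕ} {j : ℕ} (h : ∀ i < j, σ i = τ i)
    (hj : σ j = τ j) (hσ : IsChoice n P σ j) : IsChoice n P τ j := by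
  unfold IsChoice at *
  simpa only [← hj, ← IsBest.congr h] using hσ

theorem attempt_runs (hX : Bounds X n k c) (hR : ∀ a < k, R a < n) (hn : 0 < n)
    (hd : 0 < minDeg G) {m : Mem} {x t : ℕ} (ht : t ≤ X) (hm : Base G k R 6 m)
    (h2 : m.var 2 = 0) (h3 : m.var 3 = x) (h4 : m.var 4 = t) :
    Runs X (attempt c) m fun m' => Base G k R 6 m' ∧ m'.var 3 = x ∧
      ((m'.var 2 = 0 ∧ ¬ ∃ f : Fin n ≃ Fin n, ∀ v, Fits G k R c (minDeg G + x) t (v : Fin n) (f v)) ∨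
        (m'.var 2 = 1 ∧ ∃ f : Fin n ≃ Fin n, LayoutIs m' f ∧
          ∀ v, Fits G k R c (minDeg G + x) t (v : Fin n) (f v))) := by
  have hX2 := hX.two_le
  have hle := hX.n_le
  set P := Fits G k R c (minDeg G + x) t with hP
  have hPc : ∀ v a b c, P v a → P v c → a ≤ b → b ≤ c → P v b :=
    fun _ _ _ _ h1 h2 h3 h4 => h1.ordConnected h2 h3 h4
  refine Runs.seq hX2 (Runs.loop hX2 (fun j m' => Base G k R 6 m' ∧
    (m'.var 2 = 0 ∧ m'.var 3 = x ∧ m'.var 4 = t) ∧ ∀ j' < j, IsChoice n P (m'.arr 3) j')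
    ?_ ⟨hm, ⟨h2, h3, h4⟩, by simp⟩ ?_ ?_)
  · rw [Expr.eval, hm.var_zero]; omega
  · rw [Expr.eval, hm.var_zero]
    rintro j hj m₁ ⟨b₁, ⟨e2, e3, e4⟩, hσ⟩
    set m₂ := m₁.setVar 5 j with hm₂
    have b₂ : Base G k R 6 m₂ := b₁.setVar (by omega) j
    obtain ⟨v, hv, hbest⟩ := b₂.ev_choose hX hR (s := Tm.add Tm.minDeg (Tm.var 3)) (t := Tm.var 4)
      (j := Tm.var 5) (s' := minDeg G + x) (t' := t) (j' := j)
      (Ev.add hX2 (b₂.ev_minDeg hX hn) ((Ev.var hX2 (by omega)).of_eq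
        (by rw [hm₂, setVar_var_ne _ _ (by omega), e3])))
      ((Ev.var hX2 (by omega)).of_eq (by rw [hm₂, setVar_var_ne _ _ (by omega), e4]))
      ((Ev.var hX2 (by omega)).of_eq (by rw [hm₂, setVar_var_self])) (by omega) ht hj
    refine Runs.seq hX2 (hv.run.imp fun m₃ h₃ => Runs.put hX2 ?_)
    have hz : ∀ z, z < 5 → m₃.var z = m₁.var z := fun z hz => by
      rw [h₃.1.1 z (by omega), hm₂, setVar_var_ne _ _ (by omega)]
    have h5 : m₃.var 5 = j := by rw [h₃.1.1 5 (by omega), hm₂, setVar_var_self]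
    simp only [Expr.eval, h5, h₃.2]
    refine ⟨(b₂.mono le_rfl h₃.1).setArr (by omega) (by omega) _ _, ?_, fun j' hj' => ?_⟩
    · simp only [setArr_var]
      rw [hz 2 (by omega), hz 3 (by omega), hz 4 (by omega)]
      exact ⟨e2, e3, e4⟩
    · have ha : m₃.arr 3 = m₁.arr 3 := by rw [h₃.1.2]; rfl
      rw [setArr_arr_self, ha]
      have hup : ∀ i < j, m₁.arr 3 i = Function.update (m₁.arr 3) j v i := fun i hi => by
        rw [Function.update_of_ne hi.ne]
      rcases Nat.lt_succ_iff_lt_or_eq.1 hj' with hj' | rfl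
      · exact (hσ j' hj').congr (fun i hi => hup i (by omega)) (hup _ hj')
      · unfold IsChoice
        simp only [Function.update_self, ← IsBest.congr hup]
        exact hbest
  · rw [Expr.eval, hm.var_zero]
    rintro m₁ ⟨b₁, ⟨e2, e3, e4⟩, hσ⟩
    refine Runs.seq hX2 ((Ev.all hX2 (F := fun j => m₁.arr 3 j < n) (b₁.ev_n hX2) (by omega)
      fun d₁ hd₁ m₂ hm₂ j _ y hy => Ev.lt hX2 ((Ev.get hX2 3 hy).of_eq (by rw [hm₂.2]))
        ((b₁.mono hd₁ hm₂).ev_n hX2)).run.imp fun m₃ h₃ => ?_)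
    have b₃ := b₁.mono le_rfl h₃.1
    have e2' : m₃.var 2 = 0 := by rw [h₃.1.1 2 (by omega), e2]
    have e3' : m₃.var 3 = x := by rw [h₃.1.1 3 (by omega), e3]
    refine Runs.ite hX2 (fun h => ?_) fun h => ?_
    · rw [Expr.eval, h₃.2, ind_ne_zero] at h
      obtain ⟨f, hf, hfσ⟩ := exists_equiv_of_greedy hσ h
      refine Runs.seq hX2 (Runs.loop hX2 (fun j m' => Base G k R 6 m' ∧ m'.var 3 = x ∧
        m'.arr 3 = m₃.arr 3 ∧ ∀ j' : Fin n, (j' : ℕ) < j → m'.arr 1 (f.symm j') = j')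
        ?_ ⟨b₃, e3', rfl, by simp⟩ ?_ ?_)
      · rw [Expr.eval, b₃.var_zero]; omega
      · rw [Expr.eval, b₃.var_zero]
        rintro j hj m₄ ⟨b₄, h5, h6, h7⟩
        refine Runs.put hX2 ?_
        simp only [Expr.eval, setVar_var_self, setVar_arr]
        refine ⟨(b₄.setVar (by omega) _).setArr (by omega) (by omega) _ _, ?_, ?_, ?_⟩
        · rw [setArr_var, setVar_var_ne _ _ (by omega), h5]
        · rw [setArr_arr_ne _ _ _ (by omega), setVar_arr, h6]
        · intro j' hj'
          rw [setArr_arr_self, setVar_arr, h6, h₃.1.2, hfσ ⟨j, hj⟩]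
          rcases Nat.lt_succ_iff_lt_or_eq.1 hj' with hj' | hj'
          · rw [Function.update_of_ne, h7 j' hj']
            intro e
            have := f.symm.injective (Fin.ext e)
            rw [this] at hj'
            exact lt_irrefl _ hj'
          · have : j' = ⟨j, hj⟩ := Fin.ext hj'
            rw [this, Function.update_self]
      · rw [Expr.eval, b₃.var_zero]
        rintro m₄ ⟨b₄, h5, _, h7⟩
        refine Runs.set hX2 ⟨b₄.setVar le_rfl _, ?_, .inr ⟨setVar_var_self .., f, fun v => ?_, hf⟩⟩
        · rw [setVar_var_ne _ _ (by omega), h5]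
        · have := h7 (f v) (f v).2
          rwa [Equiv.symm_apply_apply] at this
    · rw [Expr.eval, h₃.2] at h
      refine Runs.skip hX2 ⟨b₃, e3', .inl ⟨e2', ?_⟩⟩
      rintro ⟨f, hf⟩
      -- An entry `n` records that no vertex was available, which the greedy argument excludes when
      -- a matching exists.
      exact ind_ne_zero.2 (greedy_lt hPc hσ f hf) h

/-- The layout in the array `1` comes from the first successful box size. -/
def IsFirst (G : SimpleGraph (Fin n)) (k : ℕ) (R : ℕ → ℕ) (c : ℕ) (m : Mem) : Prop :=
  ∃ f : Fin n ≃ Fin n, LayoutIs m f ∧ ∃ x < 1 + (n / 2 - minDeg G),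
    (∃ t < 2 ^ (c * k), ∀ v, Fits G k R c (minDeg G + x) t (v : Fin n) (f v)) ∧
    ∀ y < x, ∀ t < 2 ^ (c * k),
      ¬ ∃ f : Fin n ≃ Fin n, ∀ v, Fits G k R c (minDeg G + y) t (v : Fin n) (f v)

/-- The variable `2` is a success flag: once it is 1 every later round is skipped, so the first
layout found survives. -/
theorem search_runs (hX : Bounds X n k c) (hR : ∀ a < k, R a < n) (hn : 0 < n)
    (hd : 0 < minDeg G) {m : Mem} (hm : Base G k R 6 m) (h2 : m.var 2 = 0)
    (hsome : ∃ x < 1 + (n / 2 - minDeg G), ∃ t < 2 ^ (c * k),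
      ∃ f : Fin n ≃ Fin n, ∀ v, Fits G k R c (minDeg G + x) t (v : Fin n) (f v)) :
    Runs X (search c) m fun m' => m'.arr 2 = R ∧ IsFirst G k R c m' := by
  have hX2 := hX.two_le
  have hle := hX.n_le
  -- Truncated subtraction leaves the single size `minDeg G` when this exceeds `n / 2`.
  set N := 1 + (n / 2 - minDeg G) with hN
  set T := 2 ^ (c * k) with hT
  refine Runs.seq hX2 ((Ev.add hX2 (Ev.const hX2 1) (Ev.sub hX2 (Ev.div hX2 (hm.ev_n hX2)
    (Ev.const hX2 2) (by omega) (by omega)) (hm.ev_minDeg hX hn))).run.imp fun m₁ h₁ => ?_)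
  have b₁ := hm.mono le_rfl h₁.1
  have e2 : m₁.var 2 = 0 := by rw [h₁.1.1 2 (by omega), h2]
  have hev : (Expr.var 6).eval m₁ = N := h₁.2
  refine Runs.loop hX2 (fun x m' => Base G k R 6 m' ∧ ((m'.var 2 = 0 ∧
      ∀ y < x, ∀ t < T, ¬ ∃ f : Fin n ≃ Fin n, ∀ v, Fits G k R c (minDeg G + y) t (v : Fin n) (f v)) ∨
    (m'.var 2 = 1 ∧ IsFirst G k R c m'))) ?_ ⟨b₁, .inl ⟨e2, by simp⟩⟩ ?_ ?_
  · rw [hev]; omega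
  · rw [hev]
    rintro x hx m₂ ⟨b₂, hI⟩
    have b₃ : Base G k R 6 (m₂.setVar 3 x) := b₂.setVar (by omega) x
    refine Runs.seq hX2 ((Ev.pow2 hX2 (Ev.mul hX2 (Ev.const hX2 c) (b₃.ev_k hX2) hX.c_le)
      (Nat.lt_two_pow_self.le.trans hX.pow_le)).run.imp fun m₄ h₄ => ?_)
    have b₄ := b₃.mono le_rfl h₄.1
    have e3 : m₄.var 3 = x := by rw [h₄.1.1 3 (by omega), setVar_var_self]
    have e2' : m₄.var 2 = m₂.var 2 := by rw [h₄.1.1 2 (by omega), setVar_var_ne _ _ (by omega)]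
    have ea : m₄.arr = m₂.arr := h₄.1.2
    have hev' : (Expr.var 6).eval m₄ = T := h₄.2
    refine Runs.loop hX2 (fun t m' => Base G k R 6 m' ∧ m'.var 3 = x ∧ ((m'.var 2 = 0 ∧
        (∀ y < x, ∀ t < T, ¬ ∃ f : Fin n ≃ Fin n,
          ∀ v, Fits G k R c (minDeg G + y) t (v : Fin n) (f v)) ∧
        ∀ u < t, ¬ ∃ f : Fin n ≃ Fin n, ∀ v, Fits G k R c (minDeg G + x) u (v : Fin n) (f v)) ∨
      (m'.var 2 = 1 ∧ IsFirst G k R c m'))) ?_ ⟨b₄, e3, ?_⟩ ?_ ?_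
    · rw [hev']; exact hX.pow_le
    · rw [e2']
      rcases hI with ⟨h5, h6⟩ | ⟨h5, f, h6, h7⟩
      · exact .inl ⟨h5, h6, by simp⟩
      · exact .inr ⟨h5, f, fun v => by rw [ea]; exact h6 v, h7⟩
    · rw [hev']
      rintro t ht m₅ ⟨b₅, h5, hJ⟩
      have hz : ∀ z ≠ 4, (m₅.setVar 4 t).var z = m₅.var z := fun z hz => setVar_var_ne _ _ hz
      refine Runs.ite hX2 (fun h => ?_) fun h => ?_
      · rw [Expr.eval, hz 2 (by omega)] at h
        refine Runs.skip hX2 ⟨b₅.setVar (by omega) _, by rw [hz 3 (by omega), h5], ?_⟩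
        rcases hJ with hJ | hJ
        · exact absurd hJ.1 h
        · exact .inr ⟨by rw [hz 2 (by omega)]; exact hJ.1, hJ.2⟩
      · have h' := h
        rw [Expr.eval, hz 2 (by omega)] at h'
        rcases hJ with ⟨_, h6, h7⟩ | hJ
        swap
        · exact absurd (hJ.1.symm.trans h') one_ne_zero
        refine (attempt_runs hX hR hn hd (ht.le.trans hX.pow_le) (b₅.setVar (by omega) t) h
          (by rw [hz 3 (by omega), h5]) (setVar_var_self ..)).imp ?_
        rintro m₆ ⟨b₆, h8, ⟨h9, h10⟩ | ⟨h9, f, h10, h11⟩⟩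
        · refine ⟨b₆, h8, .inl ⟨h9, h6, fun u hu => ?_⟩⟩
          rcases Nat.lt_succ_iff_lt_or_eq.1 hu with hu | rfl
          · exact h7 u hu
          · exact h10
        · exact ⟨b₆, h8, .inr ⟨h9, f, h10, x, hx, ⟨t, ht, h11⟩, h6⟩⟩
    · rw [hev']
      rintro m₅ ⟨b₅, h5, hJ⟩
      refine ⟨b₅, hJ.imp (fun h => ⟨h.1, fun y hy => ?_⟩) id⟩
      rcases Nat.lt_succ_iff_lt_or_eq.1 hy with hy | rfl
      · exact h.2.1 y hy
      · exact h.2.2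
  · rw [hev]
    rintro m' ⟨b, h | h⟩
    · obtain ⟨x, hx, t, ht, hf⟩ := hsome
      exact absurd hf (h.2 x hx t ht)
    · exact ⟨b.arr_two, h.2⟩

/-- Every run of the algorithm consists of uniformly random roots and a deterministic search. -/
theorem algorithm_run [NeZero n] {b : ℕ} (hX : Bounds X n (rootCount c b n) c)
    (hd : 0 < minDeg G) (hc : ∀ s, minDeg G ≤ s → n ≤ s * 2 ^ c) :
    ∃ F : (Fin (rootCount c b n) → Fin n) → Mem × ℕ,
      (algorithm c b).run (input G) = (PMF.uniformOfFintype _).map F ∧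
      ∀ r, (F r).2 ≤ X ^ (algorithm c b).deg ∧ RootsAre (F r).1 r ∧
        ∃ f s, LayoutIs (F r).1 f ∧ minDeg G ≤ s ∧ s ≤ max (minDeg G) (n / 2) ∧ Spread G r s f ∧
          ∀ s', minDeg G ≤ s' → s' < s → ∀ g, ¬ Spread G r s' g := by
  have hX2 := hX.two_le
  have hle := hX.n_le
  have hn : 0 < n := Nat.pos_of_neZero n
  set k := rootCount c b n with hk
  have hpre : Runs X (.seq (Tm.rootCount c b 6) (.set 1 (.var 6))) (input G) fun m =>
      m.var 0 = n ∧ m.var 1 = k ∧ m.var 2 = 0 ∧ m.arr = (input G).arr := by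
    have e0 : Ev X (Tm.var 0) 6 (input G) n := (Ev.var hX2 (by omega)).of_eq (by simp [input])
    refine Runs.seq hX2 ((Ev.mul hX2 (Ev.const hX2 c) (Ev.add hX2 (Ev.log2 hX2
      (Ev.log2 hX2 e0 (by omega)) ((Nat.log_le_self 2 n).trans (by omega)))
      (Ev.const hX2 b)) hX.c_le).run.imp fun m h => Runs.set hX2 ⟨?_, ?_, ?_, h.1.2⟩)
    · rw [setVar_var_ne _ _ (by omega), h.1.1 0 (by omega)]; simp [input]
    · rw [setVar_var_self]; exact h.2
    · rw [setVar_var_ne _ _ (by omega), h.1.1 2 (by omega)]; simp [input]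
  obtain ⟨m, t, hrun, ht, h0, h1, h2, ha⟩ := hpre
  obtain ⟨F, hF, hFr⟩ := drawRoots_run hX2 hX.k_le h0 h1
  have hmain : ∀ r : Fin k → Fin n, Runs X (search c) (F r).1 fun m' =>
      m'.arr 2 = (F r).1.arr 2 ∧ IsFirst G k ((F r).1.arr 2) c m' := by
    intro r
    obtain ⟨h3, _, h4, h5⟩ := hFr r
    refine search_runs hX (fun a ha => ?_) hn hd ⟨by omega, ?_, ?_, ?_, rfl⟩ ?_ ?_
    · rw [h5 ⟨a, ha⟩]; exact Fin.is_lt _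
    · rw [← h0]; exact h3.1 0 (by omega)
    · rw [← h1]; exact h3.1 1 (by omega)
    · rw [h4 0 (by omega), ha]
    · rw [← h2]; exact h3.1 2 (by omega)
    · have hn2 : 2 ≤ n := by have := minDeg_lt (G := G) hn; omega
      obtain ⟨f, hf⟩ := exists_spread (G := G) (r := r) hn2
      have he : max (minDeg G) (n / 2) = minDeg G + (n / 2 - minDeg G) := by omega
      obtain ⟨t, ht, hft⟩ := (spread_iff_exists_fits h5 (hc _ (le_max_left _ _)) f).1 hf
      rw [he] at hft
      exact ⟨_, by omega, t, ht, f, hft⟩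
  -- The search is deterministic for each tuple, so its final memory and cost are functions of the
  -- tuple.
  choose M τ hM hτ hroots hfirst using hmain
  refine ⟨fun r => (M r, t + ((F r).2 + τ r)), ?_, fun r => ⟨?_, fun i => ?_, ?_⟩⟩
  · rw [algorithm, Cmd.run, hrun, PMF.pure_bind, Cmd.run, hF, PMF.bind_map, PMF.map_bind,
      ← PMF.bind_pure_comp]
    refine congrArg _ (funext fun r => ?_)
    simp [hM, PMF.pure_map]
  · exact (Nat.add_le_add ht ((Nat.add_le_add (hFr r).2.1 (hτ r)).trans
      (add_le_pow_add hX2))).trans (add_le_pow_add hX2)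
  · rw [hroots r]; exact (hFr r).2.2.2 i
  · obtain ⟨f, hl, x, hx, ht, hno⟩ := hfirst r
    have h5 := (hFr r).2.2.2
    refine ⟨f, minDeg G + x, hl, by omega, by omega,
      (spread_iff_exists_fits h5 (hc _ (by omega)) f).2 ht, fun s' hs1 hs2 g hg => ?_⟩
    obtain ⟨t', ht', hg'⟩ := (spread_iff_exists_fits h5 (hc _ hs1) g).1 hg
    obtain ⟨y, rfl⟩ := Nat.exists_eq_add_of_le hs1
    exact hno y (by omega) t' ht' ⟨g, hg'⟩

end program

end DenseBandwidth

/-! ### Polynomial loop bounds and the proof of the theorem. -/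

namespace DenseBandwidth

/-- A bound for all loops of the algorithm, polynomial in `n`. -/
noncomputable def loopBound (c b : ℕ) : Polynomial ℕ :=
  (Polynomial.X + 1) ^ (c * c) * Polynomial.C (2 ^ (c * c * b)) + Polynomial.X +
    Polynomial.C (c + 2)

theorem bounds_loopBound {c : ℕ} (hc : 0 < c) (b n : ℕ) :
    Bounds ((loopBound c b).eval n) n (rootCount c b n) c := by
  have h := two_pow_mul_rootCount_le c b n
  have h1 : rootCount c b n ≤ c * rootCount c b n := Nat.le_mul_of_pos_left _ hc
  have h2 : c * rootCount c b n < 2 ^ (c * rootCount c b n) := Nat.lt_two_pow_self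
  have e : (loopBound c b).eval n = (n + 1) ^ (c * c) * 2 ^ (c * c * b) + n + (c + 2) := by
    simp only [loopBound, Polynomial.eval_add, Polynomial.eval_mul, Polynomial.eval_pow,
      Polynomial.eval_X, Polynomial.eval_one, Polynomial.eval_C]
  rw [e]
  constructor <;> omega

variable {n : ℕ} {G : SimpleGraph (Fin n)} {δ : ℝ}

theorem minDeg_pos (hn : 0 < n) (h0 : 0 < δ) (hG : IsDense δ G) : 0 < minDeg G := by
  have : (0 : ℝ) < minDeg G := lt_of_lt_of_le (by positivity) hG
  exact_mod_cast this

/-- Boxes have size at least `δ * n`, so `c ≥ 1 / δ` of them cover all positions, and `c < 2 ^ c`.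
-/
theorem le_mul_two_pow (hG : IsDense δ G) {c s : ℕ} (hc : 1 ≤ δ * c)
    (hs : minDeg G ≤ s) : n ≤ s * 2 ^ c := by
  have h1 : (n : ℝ) ≤ s * c := by
    have h2 : (minDeg G : ℝ) ≤ s := by exact_mod_cast hs
    calc (n : ℝ) ≤ n * (δ * c) := le_mul_of_one_le_right (Nat.cast_nonneg n) hc
      _ = δ * n * c := by ring
      _ ≤ s * c := by gcongr; exact hG.trans h2
  have h3 : n ≤ s * c := by exact_mod_cast h1
  exact h3.trans (Nat.mul_le_mul_left s Nat.lt_two_pow_self.le)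

theorem RootsAre.unique {k : ℕ} {m : Mem} {r r' : Fin k → Fin n} (h : RootsAre m r)
    (h' : RootsAre m r') : r = r' :=
  funext fun i => Fin.ext ((h i).symm.trans (h' i))

/-- A property that fails for at most a fraction `α` of all tuples has probability at least
`1 - α`. -/
theorem one_sub_le_uniform {β : Type*} [Fintype β] [Nonempty β] {S : Set β} {α : ℝ}
    (h : ((Set.univ \ S).ncard : ℝ) ≤ α * Fintype.card β) :
    ENNReal.ofReal (1 - α) ≤ (PMF.uniformOfFintype β).toOuterMeasure S := by
  classical
  have hpos : (0 : ℝ) < Fintype.card β := by exact_mod_cast Fintype.card_pos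
  rw [PMF.toOuterMeasure_uniformOfFintype_apply]
  have h1 : (S.ncard : ℝ) + (Set.univ \ S).ncard = Fintype.card β := by
    rw [← Set.compl_eq_univ_sdiff, ← Nat.card_eq_fintype_card]
    exact_mod_cast Set.ncard_add_ncard_compl S
  have h2 : (1 - α) ≤ S.ncard / Fintype.card β := by
    rw [le_div_iff₀ hpos]; linarith
  refine (ENNReal.ofReal_le_ofReal h2).trans_eq ?_
  rw [ENNReal.ofReal_div_of_pos hpos, ENNReal.ofReal_natCast, ENNReal.ofReal_natCast]
  congr 2
  rw [Set.ncard_eq_toFinset_card', Set.toFinset_card]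

end DenseBandwidth

open DenseBandwidth
theorem theorem1 :
    ∃ A : ℝ, ∀ δ α : ℝ, 0 < δ → δ < 1 → 0 < α → α < 1 →
      ∃ (P : DenseBandwidth.Cmd) (k : ℕ → ℕ) (T : Polynomial ℕ),
        (∀ᶠ n : ℕ in atTop, (k n : ℝ) ≤ A / δ * Real.log (Real.log n)) ∧
        ∀ (n : ℕ) (G : SimpleGraph (Fin n)), 0 < n → DenseBandwidth.IsDense δ G →
          (∀ o ∈ (P.run (DenseBandwidth.input G)).support,
            o.2 ≤ T.eval n ∧
            ∃ (r : Fin (k n) → Fin n) (f : Fin n ≃ Fin n),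
              DenseBandwidth.RootsAre o.1 r ∧ DenseBandwidth.LayoutIs o.1 f ∧
              DenseBandwidth.IsResult G (Set.range r) f ∧
              (DenseBandwidth.IsHopDominating G 2 (Set.range r) →
                DenseBandwidth.width G f ≤ 6 * DenseBandwidth.bandwidth G)) ∧
          (∀ r : Fin (k n) → Fin n,
            (P.run (DenseBandwidth.input G)).toOuterMeasure
              {o | DenseBandwidth.RootsAre o.1 r} = ((n : ENNReal) ^ k n)⁻¹) ∧
          ENNReal.ofReal (1 - α) ≤
            (P.run (DenseBandwidth.input G)).toOuterMeasure
              {o | ∃ (r : Fin (k n) → Fin n) (f : Fin n ≃ Fin n),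
                DenseBandwidth.RootsAre o.1 r ∧ DenseBandwidth.LayoutIs o.1 f ∧
                DenseBandwidth.IsHopDominating G 2 (Set.range r) ∧
                DenseBandwidth.width G f ≤ 6 * DenseBandwidth.bandwidth G} := by
  refine ⟨8, fun δ α h0 h1 hα _ => ?_⟩
  set c := ⌈1 / δ⌉₊ with hc
  have hc1 : 1 ≤ δ * c := by
    have := Nat.le_ceil (1 / δ)
    rwa [div_le_iff₀ h0, mul_comm] at this
  have hc2 : (c : ℝ) ≤ 2 / δ := by
    have h2 := Nat.ceil_lt_add_one (a := 1 / δ) (by positivity)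
    have h3 : 1 ≤ 1 / δ := by rw [le_div_iff₀ h0]; linarith
    have h4 : 2 / δ = 1 / δ + 1 / δ := by ring
    linarith
  have hc0 : 0 < c := Nat.ceil_pos.2 (by positivity)
  obtain ⟨b, hb⟩ : ∃ b : ℕ, 2 * c ≤ α * 2 ^ b := by
    obtain ⟨b, hb⟩ := pow_unbounded_of_one_lt (2 * c / α) (one_lt_two (α := ℝ))
    exact ⟨b, by rw [div_lt_iff₀ hα] at hb; linarith⟩
  refine ⟨algorithm c b, rootCount c b, loopBound c b ^ (algorithm c b).deg,
    eventually_rootCount_le h0 hc2 b, fun n G hn hG => ?_⟩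
  have : NeZero n := ⟨hn.ne'⟩
  have hd := minDeg_pos hn h0 hG
  obtain ⟨F, hF, hFr⟩ := algorithm_run (bounds_loopBound hc0 b n) hd
    fun s hs => le_mul_two_pow hG hc1 hs
  have key : ∀ r, ∃ f, LayoutIs (F r).1 f ∧ IsResult G (Set.range r) f ∧
      (IsHopDominating G 2 (Set.range r) → width G f ≤ 6 * bandwidth G) := by
    intro r
    obtain ⟨-, -, f, s, hl, hs1, hs2, hf, hno⟩ := hFr r
    exact ⟨f, hl, isResult_of_spread hd hs1 hs2 hf hno, fun hr =>
      (width_le_of_spread (hd.trans_le hs1) hf hr).trans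
        (Nat.mul_le_mul_left 6 (le_bandwidth_of_no_spread hn hd hno))⟩
  rw [hF]
  refine ⟨fun o ho => ?_, fun r => ?_, ?_⟩
  · rw [PMF.support_map] at ho
    obtain ⟨r, -, rfl⟩ := ho
    obtain ⟨f, hf⟩ := key r
    exact ⟨by rw [Polynomial.eval_pow]; exact (hFr r).1, r, f, (hFr r).2.1, hf⟩
  -- The final memory determines the tuple, so the stored roots are uniform as well.
  · have hpre : F ⁻¹' {o | RootsAre o.1 r} = {r} := by
      ext r'
      exact ⟨fun h => (hFr r').2.1.unique h, fun h => by cases h; exact (hFr r).2.1⟩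
    rw [PMF.toOuterMeasure_map_apply, hpre, PMF.toOuterMeasure_apply_singleton,
      PMF.uniformOfFintype_apply]
    simp
  · rw [PMF.toOuterMeasure_map_apply]
    refine (one_sub_le_uniform (S := {r | IsHopDominating G 2 (Set.range r)}) ?_).trans
      (MeasureTheory.measure_mono fun r hr => ?_)
    · refine (card_not_isHopDominating_rootCount_le hn hG h1.le hc1 hb).trans_eq ?_
      simp
    · obtain ⟨f, hl, _, hw⟩ := key r
      exact ⟨r, f, (hFr r).2.1, hl, hr, hw hr⟩
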